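/- Setting. Let $(\Gamma,d)$ be a countable metric space. For $X\subset\Gamma$ and $r\ge 0$ put $X(r)=\{y\in\Gamma: d(y,x)\le r\text{ for some }x\in X\}$. A non-increasing $F:[0,\infty)\to(0,\infty)$ is an $F$-function if $\sup_{x}\sum_{y}F(d(x,y))<\infty$ and there is $C>0$ with $\sum_{z}F(d(x,z))F(d(z,y))\le C\,F(d(x,y))$ for all $x,y\in\Gamma$; $C_F$ denotes the infimum of such $C$. Put $G(r)=\sup_{x\in\Gamma}\sum_{y:\,d(x,y)>r}F(d(x,y))$ and $\mathscr E_t(k)=\sum_{n\ge\lceil k\rceil}t^n/n!$. To each $x\in\Gamma$ attach a finite-dimensional Hilbert space $\mathcal H_x$, and for finite $\Lambda\subset\Gamma$ let $\mathcal A_\Lambda=\mathcal B\big(\bigotimes_{x\in\Lambda}\mathcal H_x\big)$ with the operator norm; for $X\subset\Lambda$, elements of $\mathcal A_X$ and linear maps on $\mathcal A_X$ act on $\Lambda$ after tensoring with the identity. For a linear map $\Phi$ on $\mathcal A_X$ let $\|\Phi\|_{cb}=\sup_n\|\Phi\otimes \mathrm{id}_{M_n}\|$, and let $CB_0(X)$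 be the set of completely bounded $\Phi$ on $\mathcal A_X$ with $\Phi(\mathbb 1)=0$. A dissipative interaction is a family $\mathscr L=\{L_Z\}$, indexed by the finite $Z\subset\Gamma$, of linear maps $L_Z:\mathcal A_Z\to\mathcal A_Z$ in Lindblad form $$L_Z(A)=i[H_Z,A]+\sum_{j=1}^{\ell_Z}\Big(K_j^*AK_j-\tfrac12\{K_j^*K_j,A\}\Big),\qquad H_Z=H_Z^*\in\mathcal A_Z,\ K_j\in\mathcal A_Z .$$ Its $F$-norm $\|\mathscr L\|_F$ is the infimum of all $M\ge0$ such that $\sum_{Z\ni x,y}\|L_Z\|_{cb}\le M\,F(d(x,y))$ for all $x,y\in\Gamma$. For finite $\Lambda$, $R>0$ and $t\ge 0$ let $$T^\Lambda_t=\exp\Big(t\sum_{Z\subset\Lambda}L_Z\Big),\qquad T^{\Lambda,R}_t=\exp\Big(t\sum_{Z\subset\Lambda,\ \mathrm{diam}(Z)\le R}L_Z\Big).$$ Theorem. Let $F$ be an $F$-function on $(\Gamma,d)$ and $\mathscr L$ a dissipative interaction with $\|\mathscr L\|_F<\infty$; put $v=\|\mathscr L\|_FC_F$. Let $X,Y\subset\Gamma$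 be finite and disjoint, $\Lambda\subset\Gamma$ finite with $X\cup Y\subset\Lambda$, $A\in\mathcal A_X$ and $K\in CB_0(Y)$. For $t\ge0$, $r\ge0$, $R>0$ let $$E(t,r,R)=\|\mathscr L\|_F\,G(R/2)\Big(t\,|X(r)|+\frac{\mathscr E_{vt}(1+r/R)}{v\,C_F}\sum_{x\in X}\sum_{y\in\Lambda\setminus X(r)}F(d(x,y))\Big)$$ (read as $0$ if $\|\mathscr L\|_F=0$). (i) For all $t\ge0$, $r\ge0$ and $R>0$, $$\|K(T^\Lambda_t(A))\|\le\|K(T^{\Lambda,R}_t(A))\|+\|K\|_{cb}\,\|A\|\,E(t,r,R).$$ (ii) Suppose moreover that $(\Gamma,d)$ is $\nu$-regular, i.e. for some $\kappa,\nu>0$ every closed ball satisfies $|b_x(n+1)|\le\kappa(n+1)^\nu$ for all $x\in\Gamma$ and integers $n\ge0$, and that $\sum_{n\ge0}(1+n)^\nu F(n)<\infty$. Then for all $t\ge0$ and $r\ge0$, $E(t,r,R)\to0$ as $R\to\infty$, and the bound (i) recovers in this limit the Nachtergaele–Vershynina–Zagrebnov bound: $$\limsup_{R\to\infty}\Big(\|K(T^{\Lambda,R}_t(A))\|+\|K\|_{cb}\|A\|E(t,r,R)\Big)\le\frac{\|K\|_{cb}\|A\|}{C_F}\big(e^{vt}-1\big)\sum_{x\in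 X}\sum_{y\in Y}F(d(x,y)),$$ and hence $$\|K(T^\Lambda_t(A))\|\le\frac{\|K\|_{cb}\|A\|}{C_F}\big(e^{vt}-1\big)\sum_{x\in X}\sum_{y\in Y}F(d(x,y)).$$ -/

import Mathlib

open scoped ENNReal Matrix.Norms.L2Operator

/-! ### Completely bounded maps between matrix algebras -/

/-- The ampliation `Φ ⊗ 𝟙` of a linear map `Φ` on a full matrix algebra: an element of
`M_I(ℂ) ⊗ M_m(ℂ)` is regarded as an `m × m` block matrix with blocks in `M_I(ℂ)`, and `Φ` is
applied to every block. -/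
def ampliation {I : Type*} (m : Type*) (Φ : Matrix I I ℂ →ₗ[ℂ] Matrix I I ℂ) :
    Matrix (I × m) (I × m) ℂ →ₗ[ℂ] Matrix (I × m) (I × m) ℂ where
  toFun B := Matrix.of fun p q => Φ (Matrix.of fun i j => B (i, p.2) (j, q.2)) p.1 q.1
  map_add' B C := by
    ext p q
    exact congrFun (congrFun (Φ.map_add (Matrix.of fun i j => B (i, p.2) (j, q.2))
      (Matrix.of fun i j => C (i, p.2) (j, q.2))) p.1) q.1
  map_smul' c B := by
    ext p q
    exact congrFun (congrFun (Φ.map_smul c (Matrix.of fun i j => B (i, p.2) (j, q.2))) p.1) q.1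

/-- The completely bounded norm `‖Φ‖_cb = sup_n ‖Φ ⊗ 𝟙_{n × n}‖`, an extended nonnegative number.
All matrix algebras carry the operator norm of the Euclidean (Hilbert) space they act on. -/
noncomputable def cbNorm {I : Type*} [Fintype I] [DecidableEq I]
    (Φ : Matrix I I ℂ →ₗ[ℂ] Matrix I I ℂ) : ℝ≥0∞ :=
  ⨆ n : ℕ, ‖LinearMap.toContinuousLinearMap (ampliation (Fin n) Φ)‖ₑ

/-- Completely bounded maps that annihilate the identity. -/
def IsCB0 {I : Type*} [Fintype I] [DecidableEq I]
    (Φ : Matrix I I ℂ →ₗ[ℂ] Matrix I I ℂ) : Prop :=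
  cbNorm Φ < ∞ ∧ Φ 1 = 0

/-- A linear map in Lindblad form:
`A ↦ i[H, A] + ∑ⱼ (Kⱼ* A Kⱼ - ½ {Kⱼ* Kⱼ, A})` with `H` self-adjoint. -/
def IsLindblad {I : Type*} [Fintype I] [DecidableEq I]
    (Φ : Matrix I I ℂ →ₗ[ℂ] Matrix I I ℂ) : Prop :=
  ∃ (H : Matrix I I ℂ) (l : ℕ) (K : Fin l → Matrix I I ℂ), IsSelfAdjoint H ∧
    ∀ A : Matrix I I ℂ, Φ A = Complex.I • (H * A - A * H) +
      ∑ j, (star (K j) * A * K j -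
        (1 / 2 : ℂ) • (star (K j) * K j * A + A * (star (K j) * K j)))

/-! ### Quantum spin systems

The one-site Hilbert space at `x` is `ℂ^(ι x)` with `ι x` a finite type, so that the Hilbert space
of a finite volume `Λ`, the tensor product of the one-site spaces, is `ℂ^(Config ι Λ)`. -/

/-- Labels of the product basis of `⨂_{x ∈ Λ} ℂ^(ι x)`. -/
abbrev Config {Γ : Type*} (ι : Γ → Type*) (Λ : Finset Γ) : Type _ := ∀ x : {x // x ∈ Λ}, ι x

/-- The algebra of observables `𝒜_Λ`: all operators on `⨂_{x ∈ Λ} ℂ^(ι x)`. -/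
abbrev LocalAlg {Γ : Type*} (ι : Γ → Type*) (Λ : Finset Γ) : Type _ :=
  Matrix (Config ι Λ) (Config ι Λ) ℂ

/-- The identification `ℋ_Λ = ℋ_X ⊗ ℋ_{Λ ∖ X}` for `X ⊆ Λ`, on basis labels. -/
def splitConfig {Γ : Type*} [DecidableEq Γ] (ι : Γ → Type*) {X Λ : Finset Γ} (h : X ⊆ Λ) :
    Config ι Λ ≃ Config ι X × Config ι (Λ \ X) where
  toFun σ := (fun x => σ ⟨x, h x.2⟩, fun x => σ ⟨x, (Finset.mem_sdiff.1 x.2).1⟩)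
  invFun p := fun x =>
    if hx : (x : Γ) ∈ X then p.1 ⟨x, hx⟩ else p.2 ⟨x, Finset.mem_sdiff.2 ⟨x.2, hx⟩⟩
  left_inv σ := by
    funext x
    by_cases hx : (x : Γ) ∈ X <;> simp [hx]
  right_inv p := by
    refine Prod.ext (funext fun x => ?_) (funext fun x => ?_)
    · simp
    · simp [(Finset.mem_sdiff.1 x.2).2]

section Spin

variable {Γ : Type*} [DecidableEq Γ] {ι : Γ → Type*} [∀ x, Fintype (ι x)]
  [∀ x, DecidableEq (ι x)]

/-- The inclusion `𝒜_X ⊆ 𝒜_Λ`, `A ↦ A ⊗ 𝟙_{Λ ∖ X}`. -/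
noncomputable def embed {X Λ : Finset Γ} (h : X ⊆ Λ) (A : LocalAlg ι X) : LocalAlg ι Λ :=
  (Matrix.kroneckerMap (· * ·) A (1 : LocalAlg ι (Λ \ X))).submatrix
    (splitConfig ι h) (splitConfig ι h)

/-- The extension `Φ ⊗ id_{Λ ∖ X}` to `𝒜_Λ` of a linear map `Φ` on `𝒜_X`. -/
noncomputable def extend {X Λ : Finset Γ} (h : X ⊆ Λ) (Φ : LocalAlg ι X →ₗ[ℂ] LocalAlg ι X) :
    LocalAlg ι Λ →ₗ[ℂ] LocalAlg ι Λ :=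
  let e := Matrix.reindexLinearEquiv ℂ ℂ (splitConfig ι h) (splitConfig ι h)
  e.symm.toLinearMap ∘ₗ ampliation (Config ι (Λ \ X)) Φ ∘ₗ e.toLinearMap

/-- The finite-volume generator `𝓛^Λ = ∑_{Z ⊆ Λ} L_Z`. -/
noncomputable def generator (L : ∀ Z : Finset Γ, LocalAlg ι Z →ₗ[ℂ] LocalAlg ι Z)
    (Λ : Finset Γ) : LocalAlg ι Λ →ₗ[ℂ] LocalAlg ι Λ :=
  ∑ Z ∈ Λ.powerset.attach, extend (Finset.mem_powerset.1 Z.2) (L Z)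

/-- The finite-range generator `𝓛^{Λ,R}`, the sum of `L_Z` over `Z ⊆ Λ` with `diam Z ≤ R`. -/
noncomputable def generatorRange [MetricSpace Γ]
    (L : ∀ Z : Finset Γ, LocalAlg ι Z →ₗ[ℂ] LocalAlg ι Z)
    (Λ : Finset Γ) (R : ℝ) : LocalAlg ι Λ →ₗ[ℂ] LocalAlg ι Λ :=
  ∑ Z ∈ Λ.powerset.attach.filter (fun Z => Metric.diam (Z.1 : Set Γ) ≤ R),
    extend (Finset.mem_powerset.1 Z.2) (L Z)

/-- The semigroup `exp(t 𝓛)` on `𝒜_Λ`. -/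
noncomputable def semigroup {Λ : Finset Γ} (𝓛 : LocalAlg ι Λ →ₗ[ℂ] LocalAlg ι Λ) (t : ℝ) :
    LocalAlg ι Λ →L[ℂ] LocalAlg ι Λ :=
  NormedSpace.exp ((t : ℂ) • LinearMap.toContinuousLinearMap 𝓛)

/-- The dynamics `T_t^Λ = exp(t 𝓛^Λ)`. -/
noncomputable def dynamics (L : ∀ Z : Finset Γ, LocalAlg ι Z →ₗ[ℂ] LocalAlg ι Z)
    (Λ : Finset Γ) (t : ℝ) : LocalAlg ι Λ →L[ℂ] LocalAlg ι Λ :=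
  semigroup (generator L Λ) t

/-- The finite-range dynamics `T_t^{Λ,R} = exp(t 𝓛^{Λ,R})`. -/
noncomputable def dynamicsRange [MetricSpace Γ]
    (L : ∀ Z : Finset Γ, LocalAlg ι Z →ₗ[ℂ] LocalAlg ι Z)
    (Λ : Finset Γ) (R t : ℝ) : LocalAlg ι Λ →L[ℂ] LocalAlg ι Λ :=
  semigroup (generatorRange L Λ R) t

/-- The `F`-norm of an interaction: the infimum of all `M ∈ [0, ∞]` such that
`∑_{Z ∋ x, y} ‖L_Z‖_cb ≤ M F(d(x,y))` for all sites `x, y`. -/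
noncomputable def fNorm [MetricSpace Γ] (F : ℝ → ℝ)
    (L : ∀ Z : Finset Γ, LocalAlg ι Z →ₗ[ℂ] LocalAlg ι Z) : ℝ≥0∞ :=
  sInf {M : ℝ≥0∞ | ∀ x y : Γ,
    ∑' Z : {Z : Finset Γ // x ∈ Z ∧ y ∈ Z}, cbNorm (L Z) ≤ M * ENNReal.ofReal (F (dist x y))}

end Spin

/-! ### Decay functions -/

/-- `F` (only its values on `[0, ∞)` matter) is an `F`-function on the metric space `Γ`. -/
structure IsFFunction (Γ : Type*) [MetricSpace Γ] (F : ℝ → ℝ) : Prop where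
  antitone : AntitoneOn F (Set.Ici 0)
  pos : ∀ r, 0 ≤ r → 0 < F r
  summable : ∀ x : Γ, Summable fun y : Γ => F (dist x y)
  bddAbove : BddAbove (Set.range fun x : Γ => ∑' y : Γ, F (dist x y))
  convolution : ∃ C : ℝ, 0 < C ∧ ∀ x y : Γ,
    (Summable fun z : Γ => F (dist x z) * F (dist z y)) ∧
      ∑' z : Γ, F (dist x z) * F (dist z y) ≤ C * F (dist x y)

/-- The convolution constant `C_F`: the infimum of all admissible `C > 0`. -/
noncomputable def convConst (Γ : Type*) [MetricSpace Γ] (F : ℝ → ℝ) : ℝ :=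
  sInf {C : ℝ | 0 < C ∧ ∀ x y : Γ,
    ∑' z : Γ, F (dist x z) * F (dist z y) ≤ C * F (dist x y)}

/-- `G(r) = sup_x ∑_{y : d(x,y) > r} F(d(x,y))`. -/
noncomputable def tailSup (Γ : Type*) [MetricSpace Γ] (F : ℝ → ℝ) (r : ℝ) : ℝ :=
  ⨆ x : Γ, ∑' y : {y : Γ // r < dist x y}, F (dist x y)

/-- `Γ` is `ν`-regular with constant `κ`: `|b_x(n+1)| ≤ κ (n+1)^ν` for all `x` and `n ≥ 0`. -/
def IsRegularSpace (Γ : Type*) [MetricSpace Γ] (κ ν : ℝ) : Prop :=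
  0 < κ ∧ 0 < ν ∧ ∀ (x : Γ) (n : ℕ), (Metric.closedBall x ((n : ℝ) + 1)).Finite ∧
    ((Metric.closedBall x ((n : ℝ) + 1)).ncard : ℝ) ≤ κ * ((n : ℝ) + 1) ^ ν

/-- The tail `ℰ_t(k) = ∑_{n ≥ ⌈k⌉} t^n / n!` of the exponential series. -/
noncomputable def expTail (t k : ℝ) : ℝ :=
  ∑' n : ℕ, t ^ (n + ⌈k⌉₊) / ((n + ⌈k⌉₊).factorial : ℝ)

/-- The inflation `X(r) = {y : d(y,x) ≤ r for some x ∈ X}`. -/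
def inflation {Γ : Type*} [MetricSpace Γ] (X : Finset Γ) (r : ℝ) : Set Γ :=
  {y | ∃ x ∈ X, dist y x ≤ r}

open scoped Classical in
/-- With `M = ‖𝓛‖_F` and `v = M C_F`, the quantity
`M G(R/2) (t |X(r)| + ℰ_{vt}(1 + r/R) / (v C_F) ∑_{x ∈ X} ∑_{y ∈ Λ ∖ X(r)} F(d(x,y)))`.
For `M = 0` it is `0`. -/
noncomputable def rangeError {Γ : Type*} [MetricSpace Γ] (F : ℝ → ℝ) (M : ℝ)
    (X Λ : Finset Γ) (t r R : ℝ) : ℝ :=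
  let C := convConst Γ F
  let v := M * C
  M * tailSup Γ F (R / 2) *
    (t * ((inflation X r).ncard : ℝ) +
      expTail (v * t) (1 + r / R) / (v * C) *
        ∑ x ∈ X, ∑ y ∈ Λ with y ∉ inflation X r, F (dist x y))

/-!
A generator in Lindblad form gives a contraction semigroup: `‖1 + ε Φ‖ ≤ 1 + O(ε²)` by its Kraus
representation, so `exp(t Φ) = exp(t Φ / n) ^ n` has norm at most `1`. Comparing
`K ∘ exp(t 𝓛)` with `exp(t 𝓛') ∘ K`, where `𝓛'` collects the interaction terms supported off `Y`
and thus commutes with `K`, bounds `‖K (exp(t 𝓛) A)‖` by the same quantities for the terms `L_Z`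
with `Z` meeting `Y` in place of `K`. Iterating produces a sum over chains of sets from `Y` to `X`;
chains of length `j` contribute at most `M (M C)^(j-1) ∑_{x ∈ X, y ∈ Y} F(d(x,y))` by the
convolution property, where `C = C_F` and `M = ‖𝓛‖_F`. All chains together give `(e^{vt} - 1) / C`.
If the sets have diameter at most `R` and `d(X, Y) > r`, then only chains of length more than
`r / R` occur, whence the tail `ℰ_{vt}(1 + r/R)` after integration in time.

The dynamics and the finite-range dynamics differ by the terms with `diam Z > R`. Any point of such
a `Z` has distance more than `R / 2` from some other point of `Z`, which produces the factor
`G(R/2)`. The terms meeting `X(r)` are estimated trivially and the others by the chain bound.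
-/

section Semigroups

open Filter Set Topology NormedSpace

section BanachAlgebra

variable {𝔸 : Type*} [NormedRing 𝔸] [NormedAlgebra ℝ 𝔸] [CompleteSpace 𝔸] {a : 𝔸} {c : ℝ}

theorem eventually_norm_exp_smul_le (ha : ∀ ε : ℝ, 0 ≤ ε → ‖1 + ε • a‖ ≤ 1 + c * ε ^ 2)
    {δ : ℝ} (hδ : 0 < δ) : ∀ᶠ ε : ℝ in 𝓝[≥] 0, ‖exp (ε • a)‖ ≤ 1 + δ * ε := by
  have hexp : ∀ᶠ ε : ℝ in 𝓝 0, ‖exp (ε • a) - 1 - ε • a‖ ≤ δ / 2 * ‖ε‖ := by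
    have h := hasDerivAt_exp_smul_const' a (0 : ℝ)
    simpa [hasDerivAt_iff_isLittleO_nhds_zero] using
      (hasDerivAt_iff_isLittleO_nhds_zero.1 h).def (half_pos hδ)
  have hquad : ∀ᶠ ε : ℝ in 𝓝 0, c * ε < δ / 2 :=
    (Continuous.tendsto' (by fun_prop) 0 0 (by simp)).eventually_lt_const (half_pos hδ)
  filter_upwards [nhdsWithin_le_nhds hexp, nhdsWithin_le_nhds hquad, self_mem_nhdsWithin]
    with ε hε hcε hε0
  have hε0 : 0 ≤ ε := hε0
  rw [Real.norm_of_nonneg hε0] at hε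
  calc ‖exp (ε • a)‖ = ‖(1 + ε • a) + (exp (ε • a) - 1 - ε • a)‖ := by congr 1; abel
    _ ≤ (1 + c * ε ^ 2) + δ / 2 * ε := norm_add_le_of_le (ha ε hε0) hε
    _ ≤ 1 + δ * ε := by nlinarith

/-- Write `exp (t a) = exp (t a / n) ^ n` and let `n → ∞`. -/
theorem norm_exp_smul_le_one (ha : ∀ ε : ℝ, 0 ≤ ε → ‖1 + ε • a‖ ≤ 1 + c * ε ^ 2)
    {t : ℝ} (ht : 0 ≤ t) : ‖exp (t • a)‖ ≤ 1 := by
  let _ := NormedAlgebra.restrictScalars ℚ ℝ 𝔸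
  have hexp : ∀ δ : ℝ, 0 < δ → ‖exp (t • a)‖ ≤ Real.exp (δ * t) := by
    intro δ hδ
    have hsmall : Tendsto (fun n : ℕ => t / n) atTop (𝓝[≥] 0) :=
      tendsto_nhdsWithin_iff.2 ⟨tendsto_const_div_atTop_nhds_zero_nat t,
        Eventually.of_forall fun n => div_nonneg ht n.cast_nonneg⟩
    obtain ⟨n, hn, hn0⟩ := ((hsmall.eventually (eventually_norm_exp_smul_le ha hδ)).and
      (eventually_gt_atTop 0)).exists
    have hn' : (n : ℝ) ≠ 0 := Nat.cast_ne_zero.2 hn0.ne'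
    calc ‖exp (t • a)‖ = ‖exp ((t / n) • a) ^ n‖ := by
          rw [← exp_nsmul, ← Nat.cast_smul_eq_nsmul ℝ, smul_smul, mul_div_cancel₀ t hn']
      _ ≤ ‖exp ((t / n) • a)‖ ^ n := norm_pow_le' _ hn0
      _ ≤ (1 + δ * (t / n)) ^ n := by gcongr
      _ ≤ Real.exp (δ * (t / n)) ^ n := by
          gcongr
          rw [add_comm]
          exact Real.add_one_le_exp _
      _ = Real.exp (δ * t) := by
          rw [← Real.exp_nat_mul]
          congr 1
          field_simp
  have hlim : Tendsto (fun δ : ℝ => Real.exp (δ * t)) (𝓝[>] 0) (𝓝 1) :=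
    (Continuous.tendsto' (by fun_prop) 0 1 (by simp)).mono_left nhdsWithin_le_nhds
  exact ge_of_tendsto hlim (eventually_nhdsWithin_of_forall hexp)

end BanachAlgebra

variable {E : Type*} [NormedAddCommGroup E] [NormedSpace ℂ E] [CompleteSpace E]

theorem norm_exp_smul_apply_le {a : E →L[ℂ] E} {c : ℝ} (hc : 0 ≤ c)
    (ha : ∀ ε : ℝ, 0 ≤ ε → ∀ x, ‖x + ε • a x‖ ≤ (1 + c * ε ^ 2) * ‖x‖) {t : ℝ} (ht : 0 ≤ t)
    (x : E) : ‖exp (t • a) x‖ ≤ ‖x‖ := by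
  have hexp : ‖exp (t • a)‖ ≤ 1 := norm_exp_smul_le_one (a := a) (c := c)
    (fun ε hε => ContinuousLinearMap.opNorm_le_bound _ (by positivity) (ha ε hε)) ht
  simpa only [one_mul] using (exp (t • a)).le_of_opNorm_le hexp x

theorem hasDerivAt_exp_smul_apply (a : E →L[ℂ] E) {y : ℝ → E} {y' : E} {u : ℝ → ℝ} {u' s : ℝ}
    (hu : HasDerivAt u u' s) (hy : HasDerivAt y y' s) :
    HasDerivAt (fun s => exp (u s • a) (y s))
      (u' • exp (u s • a) (a (y s)) + exp (u s • a) y') s := by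
  have hexp : HasDerivAt (fun s => (exp (u s • a)).restrictScalars ℝ)
      ((u' • (exp (u s • a) * a)).restrictScalars ℝ) s :=
    (ContinuousLinearMap.restrictScalarsL ℂ E E ℝ ℝ).hasFDerivAt.comp_hasDerivAt s
      ((hasDerivAt_exp_smul_const a (u s)).scomp s hu)
  exact hexp.clm_apply hy

/-- Duhamel's principle: if `exp (s b)` is contractive, an approximate solution of `y' = b y` stays
within the accumulated defect of the exact one. -/
theorem norm_sub_exp_smul_le {b : E →L[ℂ] E} (hb : ∀ s : ℝ, 0 ≤ s → ‖exp (s • b)‖ ≤ 1)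
    {y y' : ℝ → E} (hy : ∀ s, HasDerivAt y (y' s) s) {β β' : ℝ → ℝ} (hβ₀ : β 0 = 0)
    (hβ : ∀ s, HasDerivAt β (β' s) s) (hdefect : ∀ s, 0 ≤ s → ‖y' s - b (y s)‖ ≤ β' s)
    {t : ℝ} (ht : 0 ≤ t) : ‖y t - exp (t • b) (y 0)‖ ≤ β t := by
  have hderiv : ∀ s, HasDerivAt (fun s => exp ((t - s) • b) (y s) - exp (t • b) (y 0))
      (exp ((t - s) • b) (y' s - b (y s))) s := fun s => by
    convert! (hasDerivAt_exp_smul_apply b ((hasDerivAt_id s).const_sub t) (hy s)).sub_const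
      (exp (t • b) (y 0)) using 1
    rw [map_sub, neg_one_smul, neg_add_eq_sub, id]
  simpa using image_norm_le_of_norm_deriv_right_le_deriv_boundary (a := 0) (b := t)
    (fun s _ => (hderiv s).continuousAt.continuousWithinAt)
    (fun s _ => (hderiv s).hasDerivWithinAt) (by simp [hβ₀]) hβ
    (fun s hs => ((exp ((t - s) • b)).le_of_opNorm_le (hb _ (sub_nonneg.2 hs.2.le)) _).trans
      ((one_mul _).trans_le (hdefect s hs.1)))
    (right_mem_Icc.2 ht)

end Semigroups

section ExpTail

open Finset

theorem hasDerivAt_pow_succ_div_factorial (n : ℕ) (t : ℝ) :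
    HasDerivAt (fun t : ℝ => t ^ (n + 1) / ((n + 1).factorial : ℝ))
      (t ^ n / (n.factorial : ℝ)) t := by
  convert! (hasDerivAt_pow (n + 1) t).div_const ((n + 1).factorial : ℝ) using 1
  rw [Nat.factorial_succ]
  push_cast
  field_simp

theorem expTail_eq (t q : ℝ) :
    expTail t q = Real.exp t - ∑ n ∈ range ⌈q⌉₊, t ^ n / (n.factorial : ℝ) := by
  rw [expTail, eq_sub_iff_add_eq', (Real.summable_pow_div_factorial t).sum_add_tsum_nat_add ⌈q⌉₊,
    Real.exp_eq_exp_ℝ, NormedSpace.exp_eq_tsum_div]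

theorem expTail_one (t : ℝ) : expTail t 1 = Real.exp t - 1 := by
  simp [expTail_eq]

theorem expTail_nonneg {t : ℝ} (ht : 0 ≤ t) (q : ℝ) : 0 ≤ expTail t q :=
  tsum_nonneg fun _ => by positivity

theorem expTail_le_exp {t : ℝ} (ht : 0 ≤ t) (q : ℝ) : expTail t q ≤ Real.exp t := by
  rw [expTail_eq]
  exact sub_le_self _ (sum_nonneg fun _ _ => by positivity)

theorem expTail_one_add {q : ℝ} (hq : 0 ≤ q) (t : ℝ) :
    expTail t (1 + q) = Real.exp t - 1 -
      ∑ n ∈ range ⌈q⌉₊, t ^ (n + 1) / ((n + 1).factorial : ℝ) := by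
  rw [expTail_eq, add_comm 1 q, Nat.ceil_add_one hq, sum_range_succ']
  simp only [pow_zero, Nat.factorial_zero, Nat.cast_one, div_one]
  ring

theorem expTail_zero_one_add {q : ℝ} (hq : 0 ≤ q) : expTail 0 (1 + q) = 0 := by
  simp [expTail_one_add hq]

theorem hasDerivAt_expTail_one_add {q : ℝ} (hq : 0 ≤ q) (t : ℝ) :
    HasDerivAt (fun t => expTail t (1 + q)) (expTail t q) t := by
  simp only [expTail_one_add hq, expTail_eq t q]
  exact ((Real.hasDerivAt_exp t).sub_const 1).sub
    (HasDerivAt.fun_sum fun n _ => hasDerivAt_pow_succ_div_factorial n t)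

theorem sum_pow_div_factorial_mul_le_expTail {t a D q : ℝ} {g : ℕ → ℝ} (ht : 0 ≤ t) (ha : 0 ≤ a)
    (hD : 0 ≤ D) (hzero : ∀ j < ⌈q⌉₊, g j = 0) (hg : ∀ j, g j ≤ a ^ j * D) (n : ℕ) :
    ∑ j ∈ range n, t ^ j / (j.factorial : ℝ) * g j ≤ expTail (a * t) q * D := by
  set e : ℕ → ℝ := fun j => (a * t) ^ j / (j.factorial : ℝ)
  have he : ∀ j, 0 ≤ e j := fun j => by positivity
  have hterm : ∀ j, t ^ j / (j.factorial : ℝ) * g j ≤ if j < ⌈q⌉₊ then 0 else e j * D := by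
    intro j
    split_ifs with hj
    · simp [hzero j hj]
    · calc t ^ j / (j.factorial : ℝ) * g j ≤ t ^ j / (j.factorial : ℝ) * (a ^ j * D) := by
            gcongr; exact hg j
        _ = e j * D := by simp only [e, mul_pow]; ring
  calc ∑ j ∈ range n, t ^ j / (j.factorial : ℝ) * g j
      ≤ ∑ j ∈ range n, if j < ⌈q⌉₊ then 0 else e j * D := sum_le_sum fun j _ => hterm j
    _ ≤ ∑ j ∈ range (⌈q⌉₊ + n), if j < ⌈q⌉₊ then 0 else e j * D :=
        sum_le_sum_of_subset_of_nonneg (range_subset_range.2 (Nat.le_add_left _ _)) fun j _ _ => by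
          split_ifs
          exacts [le_rfl, mul_nonneg (he j) hD]
    _ = (∑ j ∈ range n, e (j + ⌈q⌉₊)) * D := by
        rw [sum_range_add, sum_eq_zero fun j hj => if_pos (mem_range.1 hj), zero_add, sum_mul]
        exact sum_congr rfl fun j _ => by rw [if_neg (by omega), add_comm]
    _ ≤ expTail (a * t) q * D := by
        gcongr
        exact ((summable_nat_add_iff ⌈q⌉₊).2 (Real.summable_pow_div_factorial _)).sum_le_tsum _
          fun j _ => he _

end ExpTail

section FFunctions

open Finset Filter Topology

variable {Γ : Type*} [MetricSpace Γ] {F : ℝ → ℝ}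

theorem convConst_nonneg (Γ : Type*) [MetricSpace Γ] (F : ℝ → ℝ) : 0 ≤ convConst Γ F :=
  Real.sInf_nonneg fun _ h => h.1.le

namespace IsFFunction

theorem apply_dist_pos (hF : IsFFunction Γ F) (x y : Γ) : 0 < F (dist x y) :=
  hF.pos _ dist_nonneg

theorem tsum_mul_le_convConst (hF : IsFFunction Γ F) (x y : Γ) :
    ∑' z : Γ, F (dist x z) * F (dist z y) ≤ convConst Γ F * F (dist x y) := by
  rw [← div_le_iff₀ (hF.apply_dist_pos x y)]
  obtain ⟨C, hC, hconv⟩ := hF.convolution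
  refine le_csInf ⟨C, hC, fun x y => (hconv x y).2⟩ fun D hD => ?_
  exact (div_le_iff₀ (hF.apply_dist_pos x y)).2 (hD.2 x y)

theorem sum_mul_le_convConst (hF : IsFFunction Γ F) (s : Finset Γ) (x y : Γ) :
    ∑ z ∈ s, F (dist x z) * F (dist z y) ≤ convConst Γ F * F (dist x y) := by
  obtain ⟨C, -, hconv⟩ := hF.convolution
  exact ((hconv x y).1.sum_le_tsum s fun z _ =>
    (mul_pos (hF.apply_dist_pos x z) (hF.apply_dist_pos z y)).le).trans
      (hF.tsum_mul_le_convConst x y)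

theorem convConst_pos [Nonempty Γ] (hF : IsFFunction Γ F) : 0 < convConst Γ F := by
  obtain ⟨x⟩ := ‹Nonempty Γ›
  have hself : F (dist x x) * F (dist x x) ≤ convConst Γ F * F (dist x x) := by
    simpa only [sum_singleton] using hF.sum_mul_le_convConst {x} x x
  exact (hF.apply_dist_pos x x).trans_le (le_of_mul_le_mul_right hself (hF.apply_dist_pos x x))

theorem finite_closedBall (hF : IsFFunction Γ F) (x : Γ) {r : ℝ} (hr : 0 ≤ r) :
    (Metric.closedBall x r).Finite := by
  have hlarge := (hF.summable x).tendsto_cofinite_zero.eventually_lt_const (hF.pos r hr)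
  refine Set.Finite.subset hlarge fun y hy => ?_
  exact not_lt.2 <| hF.antitone dist_nonneg hr (Metric.mem_closedBall'.1 hy)

theorem finite_inflation (hF : IsFFunction Γ F) (X : Finset Γ) {r : ℝ} (hr : 0 ≤ r) :
    (inflation X r).Finite := by
  have hunion : inflation X r = ⋃ x ∈ X, Metric.closedBall x r := by
    ext y
    simp only [inflation, Set.mem_ofPred_eq, Set.mem_iUnion, Metric.mem_closedBall, exists_prop]
  rw [hunion]
  exact X.finite_toSet.biUnion fun x _ => hF.finite_closedBall x hr

theorem tailSup_nonneg (hF : IsFFunction Γ F) (r : ℝ) : 0 ≤ tailSup Γ F r :=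
  Real.iSup_nonneg fun x => tsum_nonneg fun y => (hF.apply_dist_pos x y).le

theorem bddAbove_tail (hF : IsFFunction Γ F) (r : ℝ) :
    BddAbove (Set.range fun x : Γ => ∑' y : {y : Γ // r < dist x y}, F (dist x y)) := by
  obtain ⟨B, hB⟩ := hF.bddAbove
  refine ⟨B, Set.forall_mem_range.2 fun x => ?_⟩
  exact ((hF.summable x).tsum_subtype_le _ {y : Γ | r < dist x y}
    fun y => (hF.apply_dist_pos x y).le).trans (hB ⟨x, rfl⟩)

theorem sum_filter_lt_dist_le_tailSup (hF : IsFFunction Γ F) (s : Finset Γ) (x : Γ) (r : ℝ) :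
    ∑ y ∈ s with r < dist x y, F (dist x y) ≤ tailSup Γ F r := by
  have hs : Summable fun y : {y : Γ // r < dist x y} => F (dist x y) :=
    (hF.summable x).subtype {y : Γ | r < dist x y}
  refine le_trans ?_ (le_ciSup (hF.bddAbove_tail r) x)
  rw [← sum_subtype_eq_sum_filter (f := fun y => F (dist x y))]
  exact hs.sum_le_tsum _ fun y _ => (hF.apply_dist_pos x y).le

end IsFFunction

theorem IsRegularSpace.card_filter_floor_dist_le {κ ν : ℝ} (hreg : IsRegularSpace Γ κ ν) (x : Γ)
    (s : Finset Γ) (n : ℕ) : (#{y ∈ s | ⌊dist x y⌋₊ = n} : ℝ) ≤ κ * (1 + (n : ℝ)) ^ ν := by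
  obtain ⟨-, -, hball⟩ := hreg
  obtain ⟨hfin, hcard⟩ := hball x n
  have hsub : (({y ∈ s | ⌊dist x y⌋₊ = n} : Finset Γ) : Set Γ) ⊆
      Metric.closedBall x ((n : ℝ) + 1) := by
    intro y hy
    obtain ⟨-, rfl⟩ := mem_filter.1 (mem_coe.1 hy)
    exact Metric.mem_closedBall'.2 (Nat.lt_floor_add_one (dist x y)).le
  rw [add_comm, ← Set.ncard_coe_finset]
  exact (Nat.cast_le.2 (Set.ncard_le_ncard hsub hfin)).trans hcard

theorem IsFFunction.sum_apply_dist_le (hF : IsFFunction Γ F) {κ ν : ℝ}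
    (hreg : IsRegularSpace Γ κ ν) (x : Γ) (s : Finset Γ) :
    ∑ y ∈ s, F (dist x y) ≤
      κ * ∑ n ∈ s.image fun y => ⌊dist x y⌋₊, (1 + (n : ℝ)) ^ ν * F n := by
  rw [← sum_fiberwise_of_maps_to fun y hy => mem_image_of_mem (fun y => ⌊dist x y⌋₊) hy, mul_sum]
  refine sum_le_sum fun n _ => ?_
  have hfloor : ∀ y ∈ s.filter (fun y => ⌊dist x y⌋₊ = n), F (dist x y) ≤ F n := by
    intro y hy
    obtain ⟨-, rfl⟩ := mem_filter.1 hy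
    exact hF.antitone (Set.mem_Ici.2 (Nat.cast_nonneg _)) dist_nonneg (Nat.floor_le dist_nonneg)
  calc ∑ y ∈ s with ⌊dist x y⌋₊ = n, F (dist x y)
      ≤ #{y ∈ s | ⌊dist x y⌋₊ = n} • F n := sum_le_card_nsmul _ _ _ hfloor
    _ ≤ κ * (1 + (n : ℝ)) ^ ν * F n := by
        rw [nsmul_eq_mul]
        exact mul_le_mul_of_nonneg_right (hreg.card_filter_floor_dist_le x s n)
          (hF.pos _ n.cast_nonneg).le
    _ = κ * ((1 + (n : ℝ)) ^ ν * F n) := mul_assoc _ _ _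

theorem IsFFunction.tendsto_tailSup (hF : IsFFunction Γ F) {κ ν : ℝ}
    (hreg : IsRegularSpace Γ κ ν) (hsum : Summable fun n : ℕ => (1 + (n : ℝ)) ^ ν * F n) :
    Tendsto (tailSup Γ F) atTop (𝓝 0) := by
  refine tendsto_order.2 ⟨fun a ha => Eventually.of_forall fun r =>
    ha.trans_le (hF.tailSup_nonneg r), fun ε hε => ?_⟩
  have hκ : 0 < κ := hreg.1
  obtain ⟨S, hS⟩ := summable_iff_vanishing_norm.1 hsum (ε / 2 / κ) (by positivity)
  obtain ⟨N, hN⟩ := S.exists_nat_subset_range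
  filter_upwards [eventually_ge_atTop (N : ℝ)] with r hr
  suffices tailSup Γ F r ≤ ε / 2 by linarith
  refine Real.iSup_le (fun x => Real.tsum_le_of_sum_le (fun y => (hF.apply_dist_pos x y).le)
    fun u => ?_) (by positivity)
  have hdisj : Disjoint ((u.map (Function.Embedding.subtype _)).image fun y => ⌊dist x y⌋₊) S := by
    refine disjoint_left.2 fun n hn hnS => ?_
    obtain ⟨y, hy, rfl⟩ := mem_image.1 hn
    obtain ⟨z, -, rfl⟩ := mem_map.1 hy
    exact (mem_range.1 (hN hnS)).not_ge (Nat.le_floor (hr.trans z.2.le))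
  have htail := (le_abs_self _).trans (hS _ hdisj).le
  calc ∑ y ∈ u, F (dist x y)
      = ∑ y ∈ u.map (Function.Embedding.subtype _), F (dist x y) := by rw [sum_map]; rfl
    _ ≤ κ * (ε / 2 / κ) := (hF.sum_apply_dist_le hreg x _).trans (by gcongr)
    _ = ε / 2 := by field_simp

end FFunctions

section Chains

open Finset

theorem sum_not_disjoint_le {Γ : Type*} [DecidableEq Γ] {f : Finset Γ → ℝ} (hf : ∀ Z, 0 ≤ f Z)
    (𝒵 : Finset (Finset Γ)) (Y : Finset Γ) :
    ∑ Z ∈ 𝒵 with ¬ Disjoint Z Y, f Z ≤ ∑ y ∈ Y, ∑ Z ∈ 𝒵 with y ∈ Z, f Z := by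
  simp only [sum_filter]
  rw [sum_comm]
  refine sum_le_sum fun Z _ => ?_
  have hnonneg : ∀ y ∈ Y, 0 ≤ if y ∈ Z then f Z else 0 := fun y _ => by
    split_ifs
    exacts [hf Z, le_rfl]
  split_ifs with hdisj
  · exact sum_nonneg hnonneg
  · obtain ⟨y, hyZ, hyY⟩ := not_disjoint_iff.1 hdisj
    exact (if_pos hyZ).ge.trans (single_le_sum hnonneg hyY)

/-- The weight `w Z` shared by all sets `Z` through two given sites decays like `M F`. For
`w Z = ‖L_Z‖_cb` this is the bound defining the `F`-norm, restricted to finite families. -/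
structure HasFDecay {Γ : Type*} [MetricSpace Γ] [DecidableEq Γ] (F : ℝ → ℝ) (M : ℝ)
    (w : Finset Γ → ℝ) : Prop where
  const_nonneg : 0 ≤ M
  nonneg : ∀ Z, 0 ≤ w Z
  sum_le : ∀ (𝒵 : Finset (Finset Γ)) (x y : Γ),
    ∑ Z ∈ 𝒵 with x ∈ Z ∧ y ∈ Z, w Z ≤ M * F (dist x y)

namespace HasFDecay

variable {Γ : Type*} [MetricSpace Γ] [DecidableEq Γ] {F : ℝ → ℝ} {M : ℝ} {w : Finset Γ → ℝ}

theorem sum_mul_sum_le (hw : HasFDecay F M w) {g : Γ → ℝ} (hg : ∀ z, 0 ≤ g z)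
    (𝒵 : Finset (Finset Γ)) (y : Γ) :
    ∑ Z ∈ 𝒵 with y ∈ Z, w Z * ∑ z ∈ Z, g z ≤
      M * ∑ z ∈ 𝒵.biUnion id, F (dist y z) * g z := by
  have hswap : ∑ Z ∈ 𝒵 with y ∈ Z, w Z * ∑ z ∈ Z, g z =
      ∑ z ∈ 𝒵.biUnion id, ∑ Z ∈ 𝒵 with y ∈ Z ∧ z ∈ Z, w Z * g z := by
    simp only [mul_sum]
    refine sum_comm' fun Z z => ?_
    simp only [mem_filter, mem_biUnion, id]
    tauto
  calc ∑ Z ∈ 𝒵 with y ∈ Z, w Z * ∑ z ∈ Z, g z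
      = ∑ z ∈ 𝒵.biUnion id, (∑ Z ∈ 𝒵 with y ∈ Z ∧ z ∈ Z, w Z) * g z := by
        simp only [hswap, sum_mul]
    _ ≤ ∑ z ∈ 𝒵.biUnion id, M * F (dist y z) * g z := by
        gcongr with z
        exacts [hg z, hw.sum_le 𝒵 y z]
    _ = M * ∑ z ∈ 𝒵.biUnion id, F (dist y z) * g z := by simp only [mul_sum, mul_assoc]

/-- A set of diameter larger than `R` through `x` has a point at distance more than `R / 2`
from `x`. -/
theorem sum_le_tailSup (hw : HasFDecay F M w) (hF : IsFFunction Γ F) {𝒵 : Finset (Finset Γ)}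
    {R : ℝ} (hR : 0 ≤ R) (h𝒵 : ∀ Z ∈ 𝒵, R < Metric.diam (Z : Set Γ)) (x : Γ) :
    ∑ Z ∈ 𝒵 with x ∈ Z, w Z ≤ M * tailSup Γ F (R / 2) := by
  set far := (𝒵.biUnion id).filter fun y => R / 2 < dist x y
  have hfar : ∀ Z ∈ 𝒵, ¬ Disjoint Z far := by
    intro Z hZ hdisj
    have hnear : ∀ y ∈ Z, dist x y ≤ R / 2 := fun y hy => not_lt.1 fun hlt =>
      disjoint_left.1 hdisj hy (mem_filter.2 ⟨mem_biUnion.2 ⟨Z, hZ, hy⟩, hlt⟩)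
    refine (h𝒵 Z hZ).not_ge (Metric.diam_le_of_forall_dist_le hR fun y hy z hz => ?_)
    linarith [dist_triangle_left y z x, hnear y hy, hnear z hz]
  calc ∑ Z ∈ 𝒵 with x ∈ Z, w Z
      = ∑ Z ∈ 𝒵.filter (x ∈ ·) with ¬ Disjoint Z far, w Z := by
        rw [filter_true_of_mem (s := 𝒵.filter _) fun Z hZ => hfar Z (mem_filter.1 hZ).1]
    _ ≤ ∑ y ∈ far, ∑ Z ∈ 𝒵.filter (x ∈ ·) with y ∈ Z, w Z := sum_not_disjoint_le hw.nonneg _ _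
    _ ≤ ∑ y ∈ far, M * F (dist x y) := sum_le_sum fun y _ => by
        rw [filter_filter]
        exact hw.sum_le 𝒵 x y
    _ ≤ M * tailSup Γ F (R / 2) := by
        rw [← mul_sum]
        exact mul_le_mul_of_nonneg_left (hF.sum_filter_lt_dist_le_tailSup _ x _) hw.const_nonneg

end HasFDecay

section ChainOp

variable {Γ : Type*} [DecidableEq Γ] {w : Finset Γ → ℝ} {𝒵 : Finset (Finset Γ)}
  {X Y : Finset Γ}

/-- The transfer operator of the Lieb-Robinson chain expansion: the value at `Y` of its `n`-th
power applied to `f` is the sum of `w Z₁ ⋯ w Zₙ f(Zₙ)` over the chains `Y, Z₁, …, Zₙ` of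
successively intersecting sets with `Z₁, …, Zₙ ∈ 𝒵`. -/
noncomputable def chainOp (w : Finset Γ → ℝ) (𝒵 : Finset (Finset Γ)) :
    Module.End ℝ (Finset Γ → ℝ) where
  toFun f Y := ∑ Z ∈ 𝒵 with ¬ Disjoint Z Y, w Z * f Z
  map_add' f g := by
    ext Y
    simp only [Pi.add_apply, mul_add, sum_add_distrib]
  map_smul' c f := by
    ext Y
    simp only [Pi.smul_apply, smul_eq_mul, RingHom.id_apply, mul_sum, mul_left_comm]

theorem chainOp_apply (f : Finset Γ → ℝ) :
    chainOp w 𝒵 f Y = ∑ Z ∈ 𝒵 with ¬ Disjoint Z Y, w Z * f Z := rfl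

theorem chainOp_mono (hw : ∀ Z, 0 ≤ w Z) {f g : Finset Γ → ℝ} (hfg : f ≤ g) :
    chainOp w 𝒵 f ≤ chainOp w 𝒵 g := fun _ =>
  sum_le_sum fun Z _ => mul_le_mul_of_nonneg_left (hfg Z) (hw Z)

/-- The indicator function of the sets that meet `X`, the end point of the chains. -/
noncomputable def meets (X : Finset Γ) : Finset Γ → ℝ := fun Y => if Disjoint Y X then 0 else 1

theorem chainOp_pow_one_le (hw : ∀ Z, 0 ≤ w Z) (n : ℕ) :
    (chainOp w 𝒵 ^ n) 1 ≤ fun _ => (∑ Z ∈ 𝒵, w Z) ^ n := by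
  induction n with
  | zero => intro Y; simp
  | succ n ih =>
    rw [pow_succ', Module.End.mul_apply]
    refine (chainOp_mono hw ih).trans fun Y => ?_
    have hsum : 0 ≤ ∑ Z ∈ 𝒵, w Z := sum_nonneg fun Z _ => hw Z
    rw [chainOp_apply, ← sum_mul, pow_succ']
    gcongr
    exacts [fun Z _ _ => hw Z, filter_subset _ _]

end ChainOp

section ChainBounds

variable {Γ : Type*} [MetricSpace Γ] [DecidableEq Γ] {F : ℝ → ℝ} {M : ℝ} {w : Finset Γ → ℝ}
  {𝒵 : Finset (Finset Γ)}

theorem HasFDecay.chainOp_meets_le (hw : HasFDecay F M w) (X Y : Finset Γ) :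
    chainOp w 𝒵 (meets X) Y ≤ M * ∑ x ∈ X, ∑ y ∈ Y, F (dist x y) := by
  have hnonneg : ∀ Z, 0 ≤ w Z * meets X Z := fun Z => by
    unfold meets
    split_ifs <;> simp [hw.nonneg Z]
  calc chainOp w 𝒵 (meets X) Y
      ≤ ∑ y ∈ Y, ∑ Z ∈ 𝒵 with y ∈ Z, w Z * meets X Z := sum_not_disjoint_le hnonneg 𝒵 Y
    _ = ∑ y ∈ Y, ∑ Z ∈ 𝒵.filter (y ∈ ·) with ¬ Disjoint Z X, w Z := by
        refine sum_congr rfl fun y _ => ?_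
        simp only [meets, mul_ite, mul_zero, mul_one, sum_filter (s := 𝒵.filter _), ite_not]
    _ ≤ ∑ y ∈ Y, ∑ x ∈ X, ∑ Z ∈ 𝒵.filter (y ∈ ·) with x ∈ Z, w Z :=
        sum_le_sum fun y _ => sum_not_disjoint_le hw.nonneg _ X
    _ ≤ ∑ y ∈ Y, ∑ x ∈ X, M * F (dist x y) := by
        gcongr with y _ x _
        rw [filter_filter, dist_comm]
        exact hw.sum_le 𝒵 y x
    _ = M * ∑ x ∈ X, ∑ y ∈ Y, F (dist x y) := by
        rw [sum_comm]
        simp only [mul_sum]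

theorem HasFDecay.chainOp_sum_le (hw : HasFDecay F M w) (hF : IsFFunction Γ F) (X Y : Finset Γ) :
    chainOp w 𝒵 (fun Z => ∑ x ∈ X, ∑ z ∈ Z, F (dist x z)) Y ≤
      M * convConst Γ F * ∑ x ∈ X, ∑ y ∈ Y, F (dist x y) := by
  have hFsum : ∀ z, 0 ≤ ∑ x ∈ X, F (dist x z) := fun z =>
    sum_nonneg fun x _ => (hF.apply_dist_pos x z).le
  calc chainOp w 𝒵 (fun Z => ∑ x ∈ X, ∑ z ∈ Z, F (dist x z)) Y
      = ∑ Z ∈ 𝒵 with ¬ Disjoint Z Y, w Z * ∑ z ∈ Z, ∑ x ∈ X, F (dist x z) := by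
        simp only [chainOp_apply, sum_comm (s := X)]
    _ ≤ ∑ y ∈ Y, ∑ Z ∈ 𝒵 with y ∈ Z, w Z * ∑ z ∈ Z, ∑ x ∈ X, F (dist x z) :=
        sum_not_disjoint_le (fun Z => mul_nonneg (hw.nonneg Z) (sum_nonneg fun z _ => hFsum z)) 𝒵 Y
    _ ≤ ∑ y ∈ Y, M * ∑ z ∈ 𝒵.biUnion id, F (dist y z) * ∑ x ∈ X, F (dist x z) :=
        sum_le_sum fun y _ => hw.sum_mul_sum_le hFsum 𝒵 y
    _ = M * ∑ x ∈ X, ∑ y ∈ Y, ∑ z ∈ 𝒵.biUnion id, F (dist x z) * F (dist z y) := by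
        rw [sum_comm (s := X), ← mul_sum]
        simp only [mul_sum, sum_comm (s := X), dist_comm _ (_ : Γ), mul_comm]
    _ ≤ M * ∑ x ∈ X, ∑ y ∈ Y, convConst Γ F * F (dist x y) := by
        gcongr with x _ y _
        exacts [hw.const_nonneg, hF.sum_mul_le_convConst _ x y]
    _ = M * convConst Γ F * ∑ x ∈ X, ∑ y ∈ Y, F (dist x y) := by
        simp only [← mul_sum, mul_assoc]

theorem HasFDecay.chainOp_pow_succ_meets_le (hw : HasFDecay F M w) (hF : IsFFunction Γ F)
    (X : Finset Γ) (n : ℕ) :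
    (chainOp w 𝒵 ^ (n + 1)) (meets X) ≤
      (M ^ (n + 1) * convConst Γ F ^ n) • fun Y => ∑ x ∈ X, ∑ y ∈ Y, F (dist x y) := by
  induction n with
  | zero => intro Y; simpa using hw.chainOp_meets_le X Y
  | succ n ih =>
    rw [pow_succ', Module.End.mul_apply]
    refine (chainOp_mono hw.nonneg ih).trans fun Y => ?_
    have hcoeff : 0 ≤ M ^ (n + 1) * convConst Γ F ^ n :=
      mul_nonneg (pow_nonneg hw.const_nonneg _) (pow_nonneg (convConst_nonneg Γ F) _)
    rw [map_smul, Pi.smul_apply, Pi.smul_apply, smul_eq_mul, smul_eq_mul]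
    refine (mul_le_mul_of_nonneg_left (hw.chainOp_sum_le hF X Y) hcoeff).trans_eq ?_
    ring

theorem HasFDecay.chainOp_pow_meets_le (hw : HasFDecay F M w) (hF : IsFFunction Γ F)
    {X Y : Finset Γ} (hYX : Disjoint Y X) (n : ℕ) :
    (chainOp w 𝒵 ^ n) (meets X) Y ≤
      (M * convConst Γ F) ^ n * ((∑ x ∈ X, ∑ y ∈ Y, F (dist x y)) / convConst Γ F) := by
  rcases n with - | n
  · have hsum : 0 ≤ ∑ x ∈ X, ∑ y ∈ Y, F (dist x y) :=
      sum_nonneg fun x _ => sum_nonneg fun y _ => (hF.apply_dist_pos x y).le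
    simpa [meets, hYX] using div_nonneg hsum (convConst_nonneg Γ F)
  · refine (hw.chainOp_pow_succ_meets_le hF X n Y).trans_eq ?_
    rw [Pi.smul_apply, smul_eq_mul]
    rcases isEmpty_or_nonempty Γ with _ | _
    · simp [X.eq_empty_of_isEmpty]
    · have := hF.convConst_pos.ne'
      rw [mul_pow, pow_succ (convConst Γ F)]
      field_simp

theorem chainOp_pow_meets_eq_zero {R : ℝ} (h𝒵 : ∀ Z ∈ 𝒵, Metric.diam (Z : Set Γ) ≤ R) {n : ℕ}
    {X Y : Finset Γ} (hXY : ∀ x ∈ X, ∀ y ∈ Y, n * R < dist x y) :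
    (chainOp w 𝒵 ^ n) (meets X) Y = 0 := by
  induction n generalizing Y with
  | zero =>
    exact if_pos (disjoint_left.2 fun y hyY hyX => by simpa using hXY y hyX y hyY)
  | succ n ih =>
    rw [pow_succ', Module.End.mul_apply]
    refine sum_eq_zero fun Z hZ => ?_
    obtain ⟨hZ, hZY⟩ := mem_filter.1 hZ
    obtain ⟨y, hyZ, hyY⟩ := not_disjoint_iff.1 hZY
    rw [ih fun x hx z hz => ?_, mul_zero]
    have hxy := hXY x hx y hyY
    have hzy : dist z y ≤ R :=
      (Metric.dist_le_diam_of_mem Z.finite_toSet.isBounded hz hyZ).trans (h𝒵 Z hZ)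
    push_cast at hxy
    linarith [dist_triangle x z y]

end ChainBounds

end Chains

section Picard

open Finset

variable {α : Type*} (T : Module.End ℝ (α → ℝ)) (f g : α → ℝ)

/-- The `n`-th Picard iterate for `u' = T u`, `u 0 = f`, started from the constant function `g`. -/
noncomputable def picard (n : ℕ) (t : ℝ) : α → ℝ :=
  ∑ j ∈ range n, (t ^ j / (j.factorial : ℝ)) • (T ^ j) f + (t ^ n / (n.factorial : ℝ)) • (T ^ n) g

theorem picard_apply (n : ℕ) (t : ℝ) (i : α) :
    picard T f g n t i = ∑ j ∈ range n, t ^ j / (j.factorial : ℝ) * (T ^ j) f i +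
      t ^ n / (n.factorial : ℝ) * (T ^ n) g i := by
  simp only [picard, Pi.add_apply, Finset.sum_apply, Pi.smul_apply, smul_eq_mul]

theorem picard_zero (t : ℝ) : picard T f g 0 t = g := by
  simp [picard]

theorem picard_succ_at_zero (n : ℕ) : picard T f g (n + 1) 0 = f := by
  simp [picard, sum_range_succ']

theorem hasDerivAt_picard_succ (n : ℕ) (t : ℝ) (i : α) :
    HasDerivAt (fun t => picard T f g (n + 1) t i) (T (picard T f g n t) i) t := by
  have hT : T (picard T f g n t) i =
      ∑ j ∈ range n, t ^ j / (j.factorial : ℝ) * (T ^ (j + 1)) f i +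
        t ^ n / (n.factorial : ℝ) * (T ^ (n + 1)) g i := by
    simp only [picard, map_add, map_sum, map_smul, ← Module.End.mul_apply, ← pow_succ',
      Pi.add_apply, Finset.sum_apply, Pi.smul_apply, smul_eq_mul]
  simp only [picard_apply, sum_range_succ' _ n, pow_zero, Nat.factorial_zero, Nat.cast_one,
    div_one, one_mul, hT]
  exact ((HasDerivAt.fun_sum fun j _ =>
    (hasDerivAt_pow_succ_div_factorial j t).mul_const _).add_const _).add
      ((hasDerivAt_pow_succ_div_factorial n t).mul_const _)

end Picard

section MatrixAlgebras

open Matrix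

theorem ampliation_kronecker_one {I m : Type*} [DecidableEq m]
    (Φ : Matrix I I ℂ →ₗ[ℂ] Matrix I I ℂ) (A : Matrix I I ℂ) :
    ampliation m Φ (kroneckerMap (· * ·) A 1) = kroneckerMap (· * ·) (Φ A) 1 := by
  ext p q
  have hblock : (Matrix.of fun i j => kroneckerMap (· * ·) A (1 : Matrix m m ℂ) (i, p.2) (j, q.2)) =
      (1 : Matrix m m ℂ) p.2 q.2 • A := by
    ext i j
    simp only [Matrix.of_apply, kroneckerMap_apply, Matrix.smul_apply, smul_eq_mul, mul_comm]
  change Φ (Matrix.of fun i j => kroneckerMap (· * ·) A (1 : Matrix m m ℂ) (i, p.2) (j, q.2))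
    p.1 q.1 = _
  rw [hblock, map_smul, Matrix.smul_apply, smul_eq_mul, mul_comm, kroneckerMap_apply]

theorem eq_zero_of_map_one_eq_zero {I : Type*} [Subsingleton I] [DecidableEq I]
    {Φ : Matrix I I ℂ →ₗ[ℂ] Matrix I I ℂ} (h : Φ 1 = 0) : Φ = 0 := by
  refine LinearMap.ext fun A => Matrix.ext fun i j => ?_
  have hA : A = A i i • (1 : Matrix I I ℂ) := by
    ext k l
    obtain rfl := Subsingleton.elim i k
    obtain rfl := Subsingleton.elim i l
    simp only [Matrix.smul_apply, one_apply_eq, smul_eq_mul, mul_one]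
  rw [hA, map_smul, h, smul_zero, LinearMap.zero_apply]

variable {I J m : Type*} [Fintype I] [DecidableEq I] [Fintype J] [DecidableEq J]
  [Fintype m] [DecidableEq m]

/-- The inclusion `A ↦ A ⊗ 𝟙` of `M_I(ℂ)` into `M_I(ℂ) ⊗ M_m(ℂ)`, as a star algebra
homomorphism. -/
noncomputable def tensorOne (I m : Type*) [Fintype I] [DecidableEq I] [Fintype m]
    [DecidableEq m] : Matrix I I ℂ →⋆ₐ[ℂ] Matrix (I × m) (I × m) ℂ where
  toFun A := kroneckerMap (· * ·) A 1
  map_one' := one_kronecker_one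
  map_mul' A B := by
    have h := mul_kronecker_mul A B (1 : Matrix m m ℂ) (1 : Matrix m m ℂ)
    rwa [Matrix.one_mul] at h
  map_zero' := zero_kronecker _
  map_add' A B := add_kronecker A B _
  commutes' c := by
    rw [Algebra.algebraMap_eq_smul_one, Algebra.algebraMap_eq_smul_one]
    exact (smul_kronecker c _ _).trans (congrArg _ one_kronecker_one)
  map_star' A := by
    have h := conjTranspose_kronecker A (1 : Matrix m m ℂ)
    rw [conjTranspose_one] at h
    exact h.symm

/-- Relabelling of the orthonormal basis along a bijection, as a star algebra homomorphism. -/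
def relabel (e : J ≃ I) : Matrix I I ℂ →⋆ₐ[ℂ] Matrix J J ℂ where
  toFun A := A.submatrix e e
  map_one' := submatrix_one_equiv e
  map_mul' A B := (submatrix_mul_equiv A B e e e).symm
  map_zero' := rfl
  map_add' _ _ := rfl
  commutes' c := by
    rw [Algebra.algebraMap_eq_smul_one, Algebra.algebraMap_eq_smul_one]
    ext i j
    simp [Matrix.one_apply]
  map_star' _ := rfl

theorem tensorOne_apply (A : Matrix I I ℂ) (p q : I × m) :
    tensorOne I m A p q = A p.1 q.1 * (1 : Matrix m m ℂ) p.2 q.2 := rfl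

theorem relabel_symm_relabel (e : J ≃ I) (A : Matrix I I ℂ) :
    relabel e.symm (relabel e A) = A := by
  ext i j
  change A (e (e.symm i)) (e (e.symm j)) = A i j
  simp only [Equiv.apply_symm_apply]

theorem norm_relabel (e : J ≃ I) (A : Matrix I I ℂ) : ‖relabel e A‖ = ‖A‖ := by
  refine le_antisymm (NonUnitalStarAlgHom.norm_apply_le _ A) ?_
  calc ‖A‖ = ‖relabel e.symm (relabel e A)‖ := by rw [relabel_symm_relabel]
    _ ≤ ‖relabel e A‖ := NonUnitalStarAlgHom.norm_apply_le _ _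

theorem ampliation_mulLeftRight (a b : Matrix I I ℂ) :
    ampliation m (LinearMap.mulLeftRight ℂ (a, b)) =
      LinearMap.mulLeftRight ℂ (tensorOne I m a, tensorOne I m b) := by
  ext B ⟨i, p⟩ ⟨j, q⟩
  simp [ampliation, Matrix.mul_apply, Fintype.sum_prod_type, tensorOne_apply, one_apply]

theorem norm_ampliation_le {Φ : Matrix I I ℂ →ₗ[ℂ] Matrix I I ℂ} (hΦ : cbNorm Φ < ∞)
    (B : Matrix (I × m) (I × m) ℂ) : ‖ampliation m Φ B‖ ≤ (cbNorm Φ).toReal * ‖B‖ := by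
  let e : I × Fin (Fintype.card m) ≃ I × m :=
    Equiv.prodCongr (Equiv.refl I) (Fintype.equivFin m).symm
  let Ψ := LinearMap.toContinuousLinearMap (ampliation (Fin (Fintype.card m)) Φ)
  have hΨ : ‖Ψ‖ ≤ (cbNorm Φ).toReal := by
    rw [← toReal_enorm]
    exact ENNReal.toReal_mono hΦ.ne (le_iSup
      (fun n : ℕ => ‖LinearMap.toContinuousLinearMap (ampliation (Fin n) Φ)‖ₑ) (Fintype.card m))
  calc ‖ampliation m Φ B‖ = ‖relabel e (ampliation m Φ B)‖ := (norm_relabel e _).symm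
    _ = ‖Ψ (relabel e B)‖ := rfl
    _ ≤ (cbNorm Φ).toReal * ‖relabel e B‖ := Ψ.le_of_opNorm_le hΨ _
    _ = (cbNorm Φ).toReal * ‖B‖ := by rw [norm_relabel]

theorem cbNorm_zero : cbNorm (0 : Matrix I I ℂ →ₗ[ℂ] Matrix I I ℂ) = 0 :=
  ENNReal.iSup_eq_zero.2 fun n => by
    have hampliation : ampliation (Fin n) (0 : Matrix I I ℂ →ₗ[ℂ] Matrix I I ℂ) = 0 := rfl
    rw [hampliation, map_zero, ← ofReal_norm, ContinuousLinearMap.opNorm_zero, ENNReal.ofReal_zero]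

/-- With the block column `W = (Vⱼ)ⱼ` the two sums are `W* (A ⊗ 𝟙) W` and `W* W`. -/
theorem norm_sum_star_mul_mul_le {m : Type*} [Fintype m] (V : m → Matrix I I ℂ)
    (A : Matrix I I ℂ) : ‖∑ j, star (V j) * A * V j‖ ≤ ‖∑ j, star (V j) * V j‖ * ‖A‖ := by
  classical
  let W : Matrix (I × m) I ℂ := Matrix.of fun p k => V p.2 p.1 k
  have hW (B : Matrix I I ℂ) : ∑ j, star (V j) * B * V j = Wᴴ * (tensorOne I m B * W) := by
    ext i k
    simp only [Matrix.sum_apply, Matrix.mul_assoc]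
    simp only [Matrix.mul_apply, Fintype.sum_prod_type, tensorOne_apply, W,
      conjTranspose_apply, Matrix.of_apply, Matrix.star_apply, one_apply]
    rw [Finset.sum_comm]
    simp
  have hW1 : ∑ j, star (V j) * V j = Wᴴ * W := by simpa using hW 1
  calc ‖∑ j, star (V j) * A * V j‖ = ‖Wᴴ * (tensorOne I m A * W)‖ := by rw [hW]
    _ ≤ ‖Wᴴ‖ * (‖tensorOne I m A‖ * ‖W‖) :=
        (l2_opNorm_mul _ _).trans (by gcongr; exact l2_opNorm_mul _ _)
    _ ≤ ‖W‖ * (‖A‖ * ‖W‖) := by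
        rw [l2_opNorm_conjTranspose]
        gcongr
        exact NonUnitalStarAlgHom.norm_apply_le _ A
    _ = ‖∑ j, star (V j) * V j‖ * ‖A‖ := by rw [hW1, l2_opNorm_conjTranspose_mul_self]; ring

end MatrixAlgebras

namespace IsLindblad

variable {I : Type*} [Fintype I] [DecidableEq I] {Φ Ψ : Matrix I I ℂ →ₗ[ℂ] Matrix I I ℂ}

theorem map_one (hΦ : IsLindblad Φ) : Φ 1 = 0 := by
  obtain ⟨H, l, K, -, hΦ⟩ := hΦ
  rw [hΦ]
  simp only [mul_one, one_mul, sub_self, smul_zero, zero_add]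
  exact Finset.sum_eq_zero fun j _ => by module

theorem zero : IsLindblad (0 : Matrix I I ℂ →ₗ[ℂ] Matrix I I ℂ) :=
  ⟨0, 0, Fin.elim0, IsSelfAdjoint.zero _, fun A => by simp⟩

theorem add (hΦ : IsLindblad Φ) (hΨ : IsLindblad Ψ) : IsLindblad (Φ + Ψ) := by
  obtain ⟨H, l, K, hH, hΦ⟩ := hΦ
  obtain ⟨H', l', K', hH', hΨ⟩ := hΨ
  refine ⟨H + H', l + l', Fin.append K K', hH.add hH', fun A => ?_⟩
  simp only [LinearMap.add_apply, hΦ, hΨ, Fin.sum_univ_add, Fin.append_left, Fin.append_right,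
    add_mul, mul_add]
  module

theorem sum {κ : Type*} {s : Finset κ} {Φ : κ → Matrix I I ℂ →ₗ[ℂ] Matrix I I ℂ}
    (hΦ : ∀ k ∈ s, IsLindblad (Φ k)) : IsLindblad (∑ k ∈ s, Φ k) :=
  Finset.sum_induction _ _ (fun _ _ => add) zero hΦ

/-- Here `G = -iH - ½ ∑ⱼ Kⱼ* Kⱼ`. -/
theorem exists_apply_eq (hΦ : IsLindblad Φ) :
    ∃ (G : Matrix I I ℂ) (l : ℕ) (K : Fin l → Matrix I I ℂ),
      ∀ A, Φ A = star G * A + A * G + ∑ j, star (K j) * A * K j := by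
  obtain ⟨H, l, K, hH, hΦ⟩ := hΦ
  set P := ∑ j, star (K j) * K j with hP
  have hPstar : star P = P := by simp [hP, star_sum]
  have hGstar : star (-(Complex.I • H) - (1 / 2 : ℂ) • P) = Complex.I • H - (1 / 2 : ℂ) • P := by
    simp [hH.star_eq, hPstar]
  refine ⟨-(Complex.I • H) - (1 / 2 : ℂ) • P, l, K, fun A => ?_⟩
  have hdiss : ∑ j, (star (K j) * A * K j -
      (1 / 2 : ℂ) • (star (K j) * K j * A + A * (star (K j) * K j))) =
      ∑ j, star (K j) * A * K j - (1 / 2 : ℂ) • (P * A + A * P) := by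
    rw [Finset.sum_sub_distrib, ← Finset.smul_sum, Finset.sum_add_distrib, hP,
      Finset.sum_mul, Finset.mul_sum]
  rw [hΦ, hdiss, hGstar]
  simp only [sub_mul, mul_sub, mul_neg, smul_mul_assoc, mul_smul_comm]
  module

/-- Up to second order in `ε`, the map `id + ε Φ` is completely positive, with Kraus operators
`1 + ε G` and `√ε Kⱼ`. -/
theorem exists_kraus (hΦ : IsLindblad Φ) :
    ∃ (G : Matrix I I ℂ) (l : ℕ), ∀ ε : ℝ, 0 ≤ ε → ∃ V : Option (Fin l) → Matrix I I ℂ,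
      ∀ A, ∑ o, star (V o) * A * V o = A + ε • Φ A + ε ^ 2 • (star G * A * G) := by
  obtain ⟨G, l, K, hΦ⟩ := hΦ.exists_apply_eq
  refine ⟨G, l, fun ε hε => ⟨fun o => o.elim (1 + ε • G) fun j => √ε • K j, fun A => ?_⟩⟩
  rw [Fintype.sum_option, hΦ]
  simp only [Option.elim, star_add, star_one, star_smul, star_trivial, smul_mul_assoc,
    mul_smul_comm, smul_smul, Real.mul_self_sqrt hε, ← Finset.smul_sum, add_mul, mul_add,
    one_mul, mul_one]
  module

theorem exists_norm_add_smul_le (hΦ : IsLindblad Φ) :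
    ∃ c : ℝ, 0 ≤ c ∧ ∀ ε : ℝ, 0 ≤ ε → ∀ A, ‖A + ε • Φ A‖ ≤ (1 + c * ε ^ 2) * ‖A‖ := by
  obtain ⟨G, l, hG⟩ := hΦ.exists_kraus
  refine ⟨2 * ‖G‖ ^ 2, by positivity, fun ε hε A => ?_⟩
  obtain ⟨V, hV⟩ := hG ε hε
  have hV1 : ∑ o, star (V o) * V o = 1 + ε ^ 2 • (star G * G) := by
    simpa [hΦ.map_one] using hV 1
  have hε2 (B : Matrix I I ℂ) : ‖ε ^ 2 • B‖ = ε ^ 2 * ‖B‖ := by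
    rw [norm_smul, Real.norm_of_nonneg (sq_nonneg ε)]
  have hone : ‖∑ o, star (V o) * V o‖ ≤ 1 + ε ^ 2 * ‖G‖ ^ 2 := by
    rw [hV1, sq ‖G‖, ← CStarRing.norm_star_mul_self, ← hε2]
    exact norm_add_le_of_le (IsStarProjection.one _).norm_le le_rfl
  have hGAG : ‖star G * A * G‖ ≤ ‖G‖ ^ 2 * ‖A‖ :=
    calc ‖star G * A * G‖ ≤ ‖star G‖ * ‖A‖ * ‖G‖ := norm_mul₃_le
      _ = ‖G‖ ^ 2 * ‖A‖ := by rw [norm_star]; ring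
  calc ‖A + ε • Φ A‖ = ‖∑ o, star (V o) * A * V o - ε ^ 2 • (star G * A * G)‖ := by
        rw [hV, add_sub_cancel_right]
    _ ≤ ‖∑ o, star (V o) * V o‖ * ‖A‖ + ε ^ 2 * ‖star G * A * G‖ :=
        (norm_sub_le _ _).trans (add_le_add (norm_sum_star_mul_mul_le V A) (hε2 _).le)
    _ ≤ (1 + ε ^ 2 * ‖G‖ ^ 2) * ‖A‖ + ε ^ 2 * (‖G‖ ^ 2 * ‖A‖) := by gcongr
    _ = (1 + 2 * ‖G‖ ^ 2 * ε ^ 2) * ‖A‖ := by ring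

end IsLindblad

section LocalAlgebras

variable {Γ : Type*} [DecidableEq Γ] {ι : Γ → Type*} {X Y Z Λ : Finset Γ}

/-- The configuration on `Λ` that agrees with `i` on `X` and with `σ` off `X`; in terms of it the
matrix entries of `extend h Φ B` are read off from blocks of `B`. -/
def glue (h : X ⊆ Λ) (i : Config ι X) (σ : Config ι Λ) : Config ι Λ :=
  (splitConfig ι h).symm (i, (splitConfig ι h σ).2)

theorem glue_apply (h : X ⊆ Λ) (i : Config ι X) (σ : Config ι Λ) (x : {x // x ∈ Λ}) :
    glue h i σ x = if hx : (x : Γ) ∈ X then i ⟨x, hx⟩ else σ x := rfl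

theorem glue_comm (hY : Y ⊆ Λ) (hZ : Z ⊆ Λ) (hYZ : Disjoint Y Z) (i : Config ι Y)
    (k : Config ι Z) (σ : Config ι Λ) : glue hY i (glue hZ k σ) = glue hZ k (glue hY i σ) := by
  funext x
  by_cases hx : (x : Γ) ∈ Y
  · simp [glue_apply, hx, Finset.disjoint_left.1 hYZ hx]
  · simp [glue_apply, hx]

theorem splitConfig_glue_fst (hY : Y ⊆ Λ) (hZ : Z ⊆ Λ) (hYZ : Disjoint Y Z) (i : Config ι Y)
    (σ : Config ι Λ) : (splitConfig ι hZ (glue hY i σ)).1 = (splitConfig ι hZ σ).1 := by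
  funext x
  simp [splitConfig, glue_apply, Finset.disjoint_right.1 hYZ x.2]

/-- The extension `Φ ↦ Φ ⊗ id_{Λ ∖ X}` as a linear map. -/
noncomputable def extendHom (h : X ⊆ Λ) :
    (LocalAlg ι X →ₗ[ℂ] LocalAlg ι X) →ₗ[ℂ] (LocalAlg ι Λ →ₗ[ℂ] LocalAlg ι Λ) where
  toFun Φ := extend h Φ
  map_add' _ _ := rfl
  map_smul' _ _ := rfl

theorem extendHom_apply (h : X ⊆ Λ) (Φ : LocalAlg ι X →ₗ[ℂ] LocalAlg ι X) :
    extendHom h Φ = extend h Φ := rfl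

theorem extend_apply (h : X ⊆ Λ) (Φ : LocalAlg ι X →ₗ[ℂ] LocalAlg ι X) (B : LocalAlg ι Λ)
    (σ τ : Config ι Λ) :
    extend h Φ B σ τ = Φ (Matrix.of fun i j => B (glue h i σ) (glue h j τ))
      (splitConfig ι h σ).1 (splitConfig ι h τ).1 := rfl

theorem extend_apply_eq_sum [∀ x, Fintype (ι x)] [∀ x, DecidableEq (ι x)] (h : X ⊆ Λ)
    (Φ : LocalAlg ι X →ₗ[ℂ] LocalAlg ι X) (B : LocalAlg ι Λ) (σ τ : Config ι Λ) :
    extend h Φ B σ τ = ∑ p : Config ι X × Config ι X, B (glue h p.1 σ) (glue h p.2 τ) *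
      Φ (Matrix.single p.1 p.2 1) (splitConfig ι h σ).1 (splitConfig ι h τ).1 := by
  have hsingle (M : LocalAlg ι X) :
      M = ∑ p : Config ι X × Config ι X, M p.1 p.2 • Matrix.single p.1 p.2 (1 : ℂ) := by
    rw [Fintype.sum_prod_type]
    simpa [Matrix.smul_single] using Matrix.matrix_eq_sum_single M
  rw [extend_apply, hsingle (Matrix.of _)]
  simp only [map_sum, map_smul, Matrix.sum_apply, Matrix.smul_apply, smul_eq_mul, Matrix.of_apply]

theorem extend_comm [∀ x, Finite (ι x)] (hY : Y ⊆ Λ) (hZ : Z ⊆ Λ) (hYZ : Disjoint Y Z)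
    (Φ : LocalAlg ι Y →ₗ[ℂ] LocalAlg ι Y) (Ψ : LocalAlg ι Z →ₗ[ℂ] LocalAlg ι Z)
    (B : LocalAlg ι Λ) : extend hY Φ (extend hZ Ψ B) = extend hZ Ψ (extend hY Φ B) := by
  classical
  have _ (x : Γ) : Fintype (ι x) := Fintype.ofFinite (ι x)
  ext σ τ
  simp only [extend_apply_eq_sum, splitConfig_glue_fst hY hZ hYZ,
    splitConfig_glue_fst hZ hY hYZ.symm, Finset.sum_mul, glue_comm hY hZ hYZ]
  rw [Finset.sum_comm]
  exact Finset.sum_congr rfl fun p _ => Finset.sum_congr rfl fun q _ => mul_right_comm _ _ _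

variable [∀ x, DecidableEq (ι x)]

theorem embed_one (h : X ⊆ Λ) : embed h (1 : LocalAlg ι X) = 1 :=
  (congrArg (Matrix.submatrix · _ _) Matrix.one_kronecker_one).trans
    (Matrix.submatrix_one_equiv (splitConfig ι h))

theorem embed_zero (h : X ⊆ Λ) : embed h (0 : LocalAlg ι X) = 0 :=
  congrArg (Matrix.submatrix · _ _) (Matrix.zero_kronecker _)

theorem extend_embed (h : X ⊆ Λ) (Φ : LocalAlg ι X →ₗ[ℂ] LocalAlg ι X) (A : LocalAlg ι X) :
    extend h Φ (embed h A) = embed h (Φ A) := by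
  have hsplit : Matrix.reindexLinearEquiv ℂ ℂ (splitConfig ι h) (splitConfig ι h) (embed h A) =
      Matrix.kroneckerMap (· * ·) A 1 := by
    simp [embed]
  exact congrArg (Matrix.submatrix · _ _)
    ((congrArg (ampliation _ Φ) hsplit).trans (ampliation_kronecker_one Φ A))

/-- `A ⊗ 𝟙` is the image of `𝟙` under left multiplication by `A`, which commutes with `Φ`. -/
theorem extend_embed_eq_zero [∀ x, Finite (ι x)] (hX : X ⊆ Λ) (hY : Y ⊆ Λ)
    (hYX : Disjoint Y X) {Φ : LocalAlg ι Y →ₗ[ℂ] LocalAlg ι Y} (hΦ : Φ 1 = 0)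
    (A : LocalAlg ι X) : extend hY Φ (embed hX A) = 0 := by
  have _ (x : Γ) : Fintype (ι x) := Fintype.ofFinite (ι x)
  have hΦ1 : extend hY Φ 1 = 0 := by
    rw [← embed_one hY, extend_embed, hΦ, embed_zero]
  have hA : embed hX A = extend hX (LinearMap.mulLeft ℂ A) 1 := by
    rw [← embed_one hX, extend_embed, LinearMap.mulLeft_apply, mul_one]
  rw [hA, extend_comm hY hX hYX, hΦ1, map_zero]

variable [∀ x, Fintype (ι x)]

/-- The inclusion `embed h : 𝒜_X ⊆ 𝒜_Λ` as a star algebra homomorphism. -/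
noncomputable def embedHom (h : X ⊆ Λ) : LocalAlg ι X →⋆ₐ[ℂ] LocalAlg ι Λ :=
  (relabel (splitConfig ι h)).comp (tensorOne _ _)

theorem norm_embed_le (h : X ⊆ Λ) (A : LocalAlg ι X) : ‖embed h A‖ ≤ ‖A‖ :=
  NonUnitalStarAlgHom.norm_apply_le (embedHom h) A

theorem extend_eq_relabel (h : X ⊆ Λ) (Φ : LocalAlg ι X →ₗ[ℂ] LocalAlg ι X) (B : LocalAlg ι Λ) :
    extend h Φ B = relabel (splitConfig ι h)
      (ampliation (Config ι (Λ \ X)) Φ (relabel (splitConfig ι h).symm B)) := rfl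

theorem norm_extend_le (h : X ⊆ Λ) {Φ : LocalAlg ι X →ₗ[ℂ] LocalAlg ι X} (hΦ : cbNorm Φ < ∞)
    (B : LocalAlg ι Λ) : ‖extend h Φ B‖ ≤ (cbNorm Φ).toReal * ‖B‖ := by
  rw [extend_eq_relabel, norm_relabel, ← norm_relabel (splitConfig ι h).symm B]
  exact norm_ampliation_le hΦ _

theorem extend_mulLeftRight (h : X ⊆ Λ) (a b : LocalAlg ι X) :
    extend h (LinearMap.mulLeftRight ℂ (a, b)) =
      LinearMap.mulLeftRight ℂ (embedHom h a, embedHom h b) := by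
  ext1 B
  have hB : relabel (splitConfig ι h) (relabel (splitConfig ι h).symm B) = B :=
    relabel_symm_relabel (splitConfig ι h).symm B
  rw [extend_eq_relabel, ampliation_mulLeftRight]
  simp only [LinearMap.mulLeftRight_apply, map_mul, embedHom, StarAlgHom.comp_apply, hB]

theorem IsLindblad.extend (h : X ⊆ Λ) {Φ : LocalAlg ι X →ₗ[ℂ] LocalAlg ι X}
    (hΦ : IsLindblad Φ) : IsLindblad (extend h Φ) := by
  obtain ⟨H, l, K, hH, hΦ⟩ := hΦ
  have hΦ' : Φ = Complex.I • (LinearMap.mulLeftRight ℂ (H, 1) - LinearMap.mulLeftRight ℂ (1, H)) +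
      ∑ j, (LinearMap.mulLeftRight ℂ (star (K j), K j) -
        (1 / 2 : ℂ) • (LinearMap.mulLeftRight ℂ (star (K j) * K j, 1) +
          LinearMap.mulLeftRight ℂ (1, star (K j) * K j))) := by
    ext1 A
    simp [hΦ]
  refine ⟨embedHom h H, l, fun j => embedHom h (K j), hH.map _, fun B => ?_⟩
  rw [← extendHom_apply, hΦ']
  simp only [map_add, map_sub, map_sum, map_smul, extendHom_apply, extend_mulLeftRight, map_mul,
    map_star, _root_.map_one]
  simp

end LocalAlgebras

section LiebRobinson

open Finset

variable {Γ : Type*} [DecidableEq Γ] {ι : Γ → Type*} {X Y Λ : Finset Γ}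
  {L : ∀ Z : Finset Γ, LocalAlg ι Z →ₗ[ℂ] LocalAlg ι Z} {𝒵 : Finset (Finset Γ)}

/-- The action of `L_Z` on `𝒜_Λ`, with junk value `0` unless `Z ⊆ Λ`. -/
noncomputable def localTerm (L : ∀ Z : Finset Γ, LocalAlg ι Z →ₗ[ℂ] LocalAlg ι Z)
    (Λ Z : Finset Γ) : LocalAlg ι Λ →ₗ[ℂ] LocalAlg ι Λ :=
  if h : Z ⊆ Λ then extend h (L Z) else 0

theorem localTerm_of_subset {Z : Finset Γ} (h : Z ⊆ Λ) : localTerm L Λ Z = extend h (L Z) :=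
  dif_pos h

/-- The generator `∑_{Z ∈ 𝒵} L_Z` on `𝒜_Λ` formed with the interaction terms of a family `𝒵`. -/
noncomputable def partialGenerator (L : ∀ Z : Finset Γ, LocalAlg ι Z →ₗ[ℂ] LocalAlg ι Z)
    (Λ : Finset Γ) (𝒵 : Finset (Finset Γ)) : LocalAlg ι Λ →ₗ[ℂ] LocalAlg ι Λ :=
  ∑ Z ∈ 𝒵, localTerm L Λ Z

theorem partialGenerator_powerset : partialGenerator L Λ Λ.powerset = generator L Λ := by
  rw [generator, partialGenerator, ← sum_attach Λ.powerset]
  exact sum_congr rfl fun Z _ => localTerm_of_subset (mem_powerset.1 Z.2)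

theorem partialGenerator_filter_diam_le [MetricSpace Γ] (R : ℝ) :
    partialGenerator L Λ (Λ.powerset.filter fun Z => Metric.diam (Z : Set Γ) ≤ R) =
      generatorRange L Λ R := by
  rw [generatorRange, partialGenerator, sum_filter, sum_filter, ← sum_attach Λ.powerset]
  refine sum_congr rfl fun Z _ => ?_
  rw [localTerm_of_subset (mem_powerset.1 Z.2)]

theorem extend_partialGenerator_sub [∀ x, Finite (ι x)] (h𝒵 : ∀ Z ∈ 𝒵, Z ⊆ Λ)
    (hY : Y ⊆ Λ) (K : LocalAlg ι Y →ₗ[ℂ] LocalAlg ι Y) (B : LocalAlg ι Λ) :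
    extend hY K (partialGenerator L Λ 𝒵 B) -
        partialGenerator L Λ (𝒵.filter (Disjoint · Y)) (extend hY K B) =
      ∑ Z ∈ 𝒵 with ¬ Disjoint Z Y, extend hY K (localTerm L Λ Z B) := by
  simp only [partialGenerator, LinearMap.sum_apply, map_sum]
  rw [sub_eq_iff_eq_add', ← sum_filter_add_sum_filter_not 𝒵 (Disjoint · Y)]
  congr 1
  refine sum_congr rfl fun Z hZ => ?_
  obtain ⟨hZ𝒵, hZY⟩ := mem_filter.1 hZ
  rw [localTerm_of_subset (h𝒵 Z hZ𝒵)]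
  exact extend_comm hY (h𝒵 Z hZ𝒵) hZY.symm K (L Z) B

variable [∀ x, Fintype (ι x)] [∀ x, DecidableEq (ι x)]

theorem norm_semigroup_apply_le {𝓛 : LocalAlg ι Λ →ₗ[ℂ] LocalAlg ι Λ} (h𝓛 : IsLindblad 𝓛) {t : ℝ}
    (ht : 0 ≤ t) (B : LocalAlg ι Λ) : ‖semigroup 𝓛 t B‖ ≤ ‖B‖ := by
  obtain ⟨c, hc, hbound⟩ := h𝓛.exists_norm_add_smul_le
  exact norm_exp_smul_apply_le (a := LinearMap.toContinuousLinearMap 𝓛) hc hbound ht B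

theorem semigroup_zero_apply (𝓛 : LocalAlg ι Λ →ₗ[ℂ] LocalAlg ι Λ) (B : LocalAlg ι Λ) :
    semigroup 𝓛 0 B = B :=
  congrArg (· B) ((congrArg NormedSpace.exp (zero_smul ℂ (LinearMap.toContinuousLinearMap 𝓛))).trans
    NormedSpace.exp_zero)

theorem hasDerivAt_semigroup_apply (𝓛 : LocalAlg ι Λ →ₗ[ℂ] LocalAlg ι Λ) (B : LocalAlg ι Λ)
    (s : ℝ) : HasDerivAt (fun s => semigroup 𝓛 s B) (𝓛 (semigroup 𝓛 s B)) s := by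
  have h : HasDerivAt (fun s : ℝ => semigroup 𝓛 s)
      (LinearMap.toContinuousLinearMap 𝓛 * semigroup 𝓛 s) s :=
    hasDerivAt_exp_smul_const' (LinearMap.toContinuousLinearMap 𝓛) s
  let eval := (ContinuousLinearMap.apply ℂ (LocalAlg ι Λ) B).restrictScalars ℝ
  exact eval.hasFDerivAt.comp_hasDerivAt s h

/-- Duhamel's principle: the approximate solution `y` of `y' = 𝓛 y` stays within the integrated
defect `β` of the exact one. -/
theorem norm_sub_semigroup_apply_le {𝓛 : LocalAlg ι Λ →ₗ[ℂ] LocalAlg ι Λ} (h𝓛 : IsLindblad 𝓛)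
    {y y' : ℝ → LocalAlg ι Λ} {β β' : ℝ → ℝ} (hy : ∀ s, HasDerivAt y (y' s) s) (hβ₀ : β 0 = 0)
    (hβ : ∀ s, HasDerivAt β (β' s) s) (hdefect : ∀ s, 0 ≤ s → ‖y' s - 𝓛 (y s)‖ ≤ β' s) {t : ℝ}
    (ht : 0 ≤ t) : ‖y t - semigroup 𝓛 t (y 0)‖ ≤ β t :=
  norm_sub_exp_smul_le (b := LinearMap.toContinuousLinearMap 𝓛)
    (fun _ hs => ContinuousLinearMap.opNorm_le_bound _ zero_le_one fun B =>
      (norm_semigroup_apply_le h𝓛 hs B).trans_eq (one_mul _).symm) hy hβ₀ hβ hdefect ht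

/-- The weights `‖L_Z‖_cb` as real numbers. -/
noncomputable def cbWeight (L : ∀ Z : Finset Γ, LocalAlg ι Z →ₗ[ℂ] LocalAlg ι Z)
    (Z : Finset Γ) : ℝ :=
  (cbNorm (L Z)).toReal

theorem cbWeight_nonneg (Z : Finset Γ) : 0 ≤ cbWeight L Z := ENNReal.toReal_nonneg

theorem isLindblad_partialGenerator (hL : ∀ Z, IsLindblad (L Z)) :
    IsLindblad (partialGenerator L Λ 𝒵) := by
  refine IsLindblad.sum fun Z _ => ?_
  unfold localTerm
  split_ifs with h
  exacts [(hL Z).extend h, IsLindblad.zero]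

theorem norm_extend_embed_le (hX : X ⊆ Λ) (hY : Y ⊆ Λ) {K : LocalAlg ι Y →ₗ[ℂ] LocalAlg ι Y}
    (hK : IsCB0 K) (A : LocalAlg ι X) :
    ‖extend hY K (embed hX A)‖ ≤ (cbNorm K).toReal * ‖A‖ * meets X Y := by
  unfold meets
  split_ifs with hYX
  · rw [extend_embed_eq_zero hX hY hYX hK.2, norm_zero, mul_zero]
  · rw [mul_one]
    exact (norm_extend_le hY hK.1 _).trans
      (mul_le_mul_of_nonneg_left (norm_embed_le hX A) ENNReal.toReal_nonneg)

/-- Compare `K ∘ exp(t 𝓛_𝒵)` with `exp(t 𝓛') ∘ K`, where `𝓛'` retains only the terms supported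
off `Y` and hence commutes with `K`. -/
theorem norm_extend_semigroup_embed_le_add (hL : ∀ Z, IsLindblad (L Z)) (h𝒵 : ∀ Z ∈ 𝒵, Z ⊆ Λ)
    (hX : X ⊆ Λ) (hY : Y ⊆ Λ) (A : LocalAlg ι X) {K : LocalAlg ι Y →ₗ[ℂ] LocalAlg ι Y}
    (hK : IsCB0 K) {β β' : ℝ → ℝ} (hβ₀ : β 0 = 0) (hβ : ∀ s, HasDerivAt β (β' s) s)
    (hmeet : ∀ s, 0 ≤ s → ∑ Z ∈ 𝒵 with ¬ Disjoint Z Y, ‖extend hY K (localTerm L Λ Z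
      (semigroup (partialGenerator L Λ 𝒵) s (embed hX A)))‖ ≤ β' s) {t : ℝ} (ht : 0 ≤ t) :
    ‖extend hY K (semigroup (partialGenerator L Λ 𝒵) t (embed hX A))‖ ≤
      (cbNorm K).toReal * ‖A‖ * meets X Y + β t := by
  set B := fun s => semigroup (partialGenerator L Λ 𝒵) s (embed hX A)
  set 𝓛' := partialGenerator L Λ (𝒵.filter (Disjoint · Y))
  have h𝓛' : IsLindblad 𝓛' := isLindblad_partialGenerator hL
  have hderiv (s : ℝ) : HasDerivAt (fun s => extend hY K (B s))
      (extend hY K (partialGenerator L Λ 𝒵 (B s))) s :=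
    have hextend := (LinearMap.toContinuousLinearMap (extend hY K)).restrictScalars ℝ |>.hasFDerivAt
    hextend.comp_hasDerivAt s (hasDerivAt_semigroup_apply _ _ s)
  have hdefect (s : ℝ) (hs : 0 ≤ s) :
      ‖extend hY K (partialGenerator L Λ 𝒵 (B s)) - 𝓛' (extend hY K (B s))‖ ≤ β' s := by
    rw [extend_partialGenerator_sub h𝒵 hY K (B s)]
    exact (norm_sum_le _ _).trans (hmeet s hs)
  have hduhamel : ‖extend hY K (B t) - semigroup 𝓛' t (extend hY K (B 0))‖ ≤ β t :=
    norm_sub_semigroup_apply_le h𝓛' hderiv hβ₀ hβ hdefect ht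
  have hinitial : ‖semigroup 𝓛' t (extend hY K (B 0))‖ ≤
      (cbNorm K).toReal * ‖A‖ * meets X Y := by
    refine (norm_semigroup_apply_le h𝓛' ht _).trans ?_
    simp only [B, semigroup_zero_apply]
    exact norm_extend_embed_le hX hY hK A
  exact (norm_le_norm_add_norm_sub' _ _).trans (add_le_add hinitial hduhamel)

/-- The maps `L_Z` themselves vanish at `𝟙`, so the induction hypothesis applies to them. -/
theorem norm_extend_semigroup_embed_le_picard (hL : ∀ Z, IsLindblad (L Z))
    (hcb : ∀ Z, cbNorm (L Z) < ∞) (h𝒵 : ∀ Z ∈ 𝒵, Z ⊆ Λ) (hX : X ⊆ Λ) (A : LocalAlg ι X) (n : ℕ)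
    (hY : Y ⊆ Λ) {K : LocalAlg ι Y →ₗ[ℂ] LocalAlg ι Y} (hK : IsCB0 K) {t : ℝ} (ht : 0 ≤ t) :
    ‖extend hY K (semigroup (partialGenerator L Λ 𝒵) t (embed hX A))‖ ≤
      (cbNorm K).toReal * ‖A‖ * picard (chainOp (cbWeight L) 𝒵) (meets X) 1 n t Y := by
  induction n generalizing Y t with
  | zero =>
    rw [picard_zero, Pi.one_apply, mul_one]
    refine (norm_extend_le hY hK.1 _).trans (mul_le_mul_of_nonneg_left ?_ ENNReal.toReal_nonneg)
    exact (norm_semigroup_apply_le (isLindblad_partialGenerator hL) ht _).trans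
      (norm_embed_le hX A)
  | succ n ih =>
    set c := (cbNorm K).toReal * ‖A‖ with hc
    set T := chainOp (cbWeight L) 𝒵
    set B := fun s => semigroup (partialGenerator L Λ 𝒵) s (embed hX A)
    have hmeet (s : ℝ) (hs : 0 ≤ s) : ∑ Z ∈ 𝒵 with ¬ Disjoint Z Y,
        ‖extend hY K (localTerm L Λ Z (B s))‖ ≤ c * T (picard T (meets X) 1 n s) Y := by
      rw [chainOp_apply, mul_sum]
      refine sum_le_sum fun Z hZ => ?_
      have hZΛ := h𝒵 Z (mem_filter.1 hZ).1
      rw [localTerm_of_subset hZΛ]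
      calc ‖extend hY K (extend hZΛ (L Z) (B s))‖
          ≤ (cbNorm K).toReal * ‖extend hZΛ (L Z) (B s)‖ := norm_extend_le hY hK.1 _
        _ ≤ (cbNorm K).toReal * (cbWeight L Z * ‖A‖ * picard T (meets X) 1 n s Z) :=
            mul_le_mul_of_nonneg_left (ih hZΛ ⟨hcb Z, (hL Z).map_one⟩ hs) ENNReal.toReal_nonneg
        _ = c * (cbWeight L Z * picard T (meets X) 1 n s Z) := by ring
    have hstep := norm_extend_semigroup_embed_le_add
      (β := fun s => c * (picard T (meets X) 1 (n + 1) s Y - meets X Y)) hL h𝒵 hX hY A hK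
      (by simp only [picard_succ_at_zero, sub_self, mul_zero])
      (fun s => ((hasDerivAt_picard_succ T (meets X) 1 n s Y).sub_const _).const_mul c) hmeet ht
    rwa [← hc, ← mul_add, add_sub_cancel] at hstep

end LiebRobinson

section DissipativeInteractions

open Finset Filter Topology

variable {Γ : Type*} [DecidableEq Γ] [MetricSpace Γ] {ι : Γ → Type*} [∀ x, Fintype (ι x)]
  [∀ x, DecidableEq (ι x)] {F : ℝ → ℝ} {M : ℝ}
  {L : ∀ Z : Finset Γ, LocalAlg ι Z →ₗ[ℂ] LocalAlg ι Z} {X Y Λ : Finset Γ}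

/-- `L` is a dissipative interaction of `F`-norm at most `M`, with the `F`-norm bound expressed
through finite sums of real numbers. -/
structure IsDissipativeInteraction (F : ℝ → ℝ) (M : ℝ)
    (L : ∀ Z : Finset Γ, LocalAlg ι Z →ₗ[ℂ] LocalAlg ι Z) : Prop where
  isLindblad : ∀ Z, IsLindblad (L Z)
  cbNorm_lt_top : ∀ Z, cbNorm (L Z) < ∞
  hasFDecay : HasFDecay F M (cbWeight L)

theorem tsum_cbNorm_le_fNorm (hF : IsFFunction Γ F) (x y : Γ) :
    ∑' Z : {Z : Finset Γ // x ∈ Z ∧ y ∈ Z}, cbNorm (L Z) ≤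
      fNorm F L * ENNReal.ofReal (F (dist x y)) := by
  have hpos : ENNReal.ofReal (F (dist x y)) ≠ 0 := by simpa using hF.apply_dist_pos x y
  rw [← ENNReal.div_le_iff hpos ENNReal.ofReal_ne_top]
  exact le_sInf fun M hM => (ENNReal.div_le_iff hpos ENNReal.ofReal_ne_top).2 (hM x y)

theorem cbNorm_lt_top_of_fNorm_lt_top (hF : IsFFunction Γ F) (hL : fNorm F L < ∞)
    {Z : Finset Γ} (hone : L Z 1 = 0) : cbNorm (L Z) < ∞ := by
  rcases Z.eq_empty_or_nonempty with rfl | ⟨x, hx⟩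
  · rw [eq_zero_of_map_one_eq_zero hone, cbNorm_zero]
    exact ENNReal.zero_lt_top
  · calc cbNorm (L Z)
        ≤ ∑' Z : {Z : Finset Γ // x ∈ Z ∧ x ∈ Z}, cbNorm (L Z) :=
          ENNReal.le_tsum (f := fun Z : {Z : Finset Γ // x ∈ Z ∧ x ∈ Z} => cbNorm (L Z)) ⟨Z, hx, hx⟩
      _ ≤ fNorm F L * ENNReal.ofReal (F (dist x x)) := tsum_cbNorm_le_fNorm hF x x
      _ < ∞ := ENNReal.mul_lt_top hL ENNReal.ofReal_lt_top

namespace IsDissipativeInteraction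

theorem of_fNorm_lt_top (hF : IsFFunction Γ F) (hLindblad : ∀ Z, IsLindblad (L Z))
    (hL : fNorm F L < ∞) : IsDissipativeInteraction F (fNorm F L).toReal L where
  isLindblad := hLindblad
  cbNorm_lt_top Z := cbNorm_lt_top_of_fNorm_lt_top hF hL (hLindblad Z).map_one
  hasFDecay :=
    { const_nonneg := ENNReal.toReal_nonneg
      nonneg := cbWeight_nonneg
      sum_le := fun 𝒵 x y => by
        have hsum : ∑ Z ∈ 𝒵 with x ∈ Z ∧ y ∈ Z, cbNorm (L Z) ≤
            fNorm F L * ENNReal.ofReal (F (dist x y)) := by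
          rw [← sum_subtype_eq_sum_filter (f := fun Z => cbNorm (L Z))]
          exact (ENNReal.sum_le_tsum _).trans (tsum_cbNorm_le_fNorm hF x y)
        have hreal := ENNReal.toReal_mono (ENNReal.mul_lt_top hL ENNReal.ofReal_lt_top).ne hsum
        rwa [ENNReal.toReal_mul, ENNReal.toReal_ofReal (hF.apply_dist_pos x y).le,
          ENNReal.toReal_sum fun Z _ =>
            (cbNorm_lt_top_of_fNorm_lt_top hF hL (hLindblad Z).map_one).ne] at hreal }

/-- The hypothesis `hq` says that no chain of fewer than `q` sets in `𝒵` leads from `Y` to `X`. -/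
theorem norm_extend_semigroup_embed_le (hL : IsDissipativeInteraction F M L)
    (hF : IsFFunction Γ F) {𝒵 : Finset (Finset Γ)} (h𝒵 : ∀ Z ∈ 𝒵, Z ⊆ Λ) (hX : X ⊆ Λ) (hY : Y ⊆ Λ)
    (hYX : Disjoint Y X) (A : LocalAlg ι X) {K : LocalAlg ι Y →ₗ[ℂ] LocalAlg ι Y} (hK : IsCB0 K)
    {q : ℝ} (hq : ∀ j < ⌈q⌉₊, (chainOp (cbWeight L) 𝒵 ^ j) (meets X) Y = 0) {t : ℝ} (ht : 0 ≤ t) :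
    ‖extend hY K (semigroup (partialGenerator L Λ 𝒵) t (embed hX A))‖ ≤
      (cbNorm K).toReal * ‖A‖ * (expTail (M * convConst Γ F * t) q *
        ((∑ x ∈ X, ∑ y ∈ Y, F (dist x y)) / convConst Γ F)) := by
  set c := (cbNorm K).toReal * ‖A‖
  set bound := expTail (M * convConst Γ F * t) q *
    ((∑ x ∈ X, ∑ y ∈ Y, F (dist x y)) / convConst Γ F)
  set W := ∑ Z ∈ 𝒵, cbWeight L Z
  have hC : 0 ≤ convConst Γ F := convConst_nonneg Γ F
  have hD : 0 ≤ (∑ x ∈ X, ∑ y ∈ Y, F (dist x y)) / convConst Γ F :=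
    div_nonneg (sum_nonneg fun x _ => sum_nonneg fun y _ => (hF.apply_dist_pos x y).le) hC
  have hpicard (n : ℕ) : picard (chainOp (cbWeight L) 𝒵) (meets X) 1 n t Y ≤
      bound + (t * W) ^ n / n.factorial := by
    rw [picard_apply]
    refine add_le_add (sum_pow_div_factorial_mul_le_expTail ht
      (mul_nonneg hL.hasFDecay.const_nonneg hC) hD hq
      (fun j => hL.hasFDecay.chainOp_pow_meets_le hF hYX j) n) ?_
    rw [mul_pow, mul_div_right_comm]
    exact mul_le_mul_of_nonneg_left (chainOp_pow_one_le cbWeight_nonneg n Y) (by positivity)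
  have hlim : Tendsto (fun n : ℕ => c * (bound + (t * W) ^ n / n.factorial)) atTop
      (𝓝 (c * bound)) := by
    simpa using
      ((FloorSemiring.tendsto_pow_div_factorial_atTop (t * W)).const_add bound).const_mul c
  refine ge_of_tendsto' hlim fun n => ?_
  exact (norm_extend_semigroup_embed_le_picard hL.isLindblad hL.cbNorm_lt_top h𝒵 hX A n hY hK
    ht).trans (mul_le_mul_of_nonneg_left (hpicard n) (by positivity))

/-- The Lieb-Robinson bound of Nachtergaele, Vershynina and Zagrebnov. -/
theorem norm_extend_dynamics_embed_le (hL : IsDissipativeInteraction F M L)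
    (hF : IsFFunction Γ F) (hXY : Disjoint X Y) (hX : X ⊆ Λ) (hY : Y ⊆ Λ) (A : LocalAlg ι X)
    {K : LocalAlg ι Y →ₗ[ℂ] LocalAlg ι Y} (hK : IsCB0 K) {t : ℝ} (ht : 0 ≤ t) :
    ‖extend hY K (dynamics L Λ t (embed hX A))‖ ≤
      (cbNorm K).toReal * ‖A‖ / convConst Γ F * (Real.exp (M * convConst Γ F * t) - 1) *
        ∑ x ∈ X, ∑ y ∈ Y, F (dist x y) := by
  have hchain : ∀ j < ⌈(1 : ℝ)⌉₊, (chainOp (cbWeight L) Λ.powerset ^ j) (meets X) Y = 0 := by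
    intro j hj
    rw [Nat.ceil_one, Nat.lt_one_iff] at hj
    rw [hj, pow_zero, Module.End.one_apply, meets, if_pos hXY.symm]
  rw [dynamics, ← partialGenerator_powerset]
  refine (hL.norm_extend_semigroup_embed_le hF (fun Z => mem_powerset.1) hX hY hXY.symm A hK
    hchain ht).trans_eq ?_
  rw [expTail_one]
  ring

end IsDissipativeInteraction

end DissipativeInteractions

section RangeError

open Finset Filter Topology

variable {Γ : Type*} [MetricSpace Γ] {F : ℝ → ℝ} {M : ℝ}

open scoped Classical in
/-- The time derivative of `rangeError`. It bounds the total action of the interaction terms of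
diameter larger than `R` on an observable from `X` evolved up to time `t` with the finite-range
dynamics. -/
noncomputable def rangeErrorRate (F : ℝ → ℝ) (M : ℝ) (X Λ : Finset Γ) (t r R : ℝ) : ℝ :=
  M * tailSup Γ F (R / 2) * ((inflation X r).ncard +
    expTail (M * convConst Γ F * t) (r / R) / convConst Γ F *
      ∑ x ∈ X, ∑ y ∈ Λ with y ∉ inflation X r, F (dist x y))

theorem hasDerivAt_rangeError (X Λ : Finset Γ) {r R : ℝ} (hq : 0 ≤ r / R) (t : ℝ) :
    HasDerivAt (fun t => rangeError F M X Λ t r R) (rangeErrorRate F M X Λ t r R) t := by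
  classical
  rcases eq_or_ne M 0 with rfl | hM
  · simpa [rangeError, rangeErrorRate] using hasDerivAt_const t (0 : ℝ)
  set C := convConst Γ F with hC
  have hexpTail : HasDerivAt (fun t => expTail (M * C * t) (1 + r / R) / (M * C * C))
      (expTail (M * C * t) (r / R) / C) t := by
    convert! ((hasDerivAt_expTail_one_add hq (M * C * t)).comp t
      (hasDerivAt_const_mul (M * C))).div_const (M * C * C) using 1
    rcases eq_or_ne C 0 with hC₀ | hC₀
    · simp [hC₀]
    · field_simp
  simp only [rangeError, rangeErrorRate, ← hC]
  exact ((hasDerivAt_mul_const _).add (hexpTail.mul_const _)).const_mul _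

theorem rangeError_zero (X Λ : Finset Γ) {r R : ℝ} (hq : 0 ≤ r / R) :
    rangeError F M X Λ 0 r R = 0 := by
  simp only [rangeError, mul_zero, zero_mul, expTail_zero_one_add hq, zero_div, add_zero]

theorem tendsto_rangeError (hF : IsFFunction Γ F) (hG : Tendsto (tailSup Γ F) atTop (𝓝 0))
    (hM : 0 ≤ M) (X Λ : Finset Γ) {t : ℝ} (ht : 0 ≤ t) (r : ℝ) :
    Tendsto (fun R => rangeError F M X Λ t r R) atTop (𝓝 0) := by
  classical
  set C := convConst Γ F
  set D := ∑ x ∈ X, ∑ y ∈ Λ with y ∉ inflation X r, F (dist x y)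
  have hC : 0 ≤ C := convConst_nonneg Γ F
  have hD : 0 ≤ D := sum_nonneg fun x _ => sum_nonneg fun y _ => (hF.apply_dist_pos x y).le
  have hlim : Tendsto (fun R : ℝ => M * tailSup Γ F (R / 2) *
      (t * (inflation X r).ncard + Real.exp (M * C * t) / (M * C * C) * D)) atTop (𝓝 0) := by
    simpa using ((hG.comp (tendsto_id.atTop_div_const two_pos)).const_mul M).mul_const _
  have hcoeff (R : ℝ) : 0 ≤ M * tailSup Γ F (R / 2) := mul_nonneg hM (hF.tailSup_nonneg _)
  have htail (q : ℝ) : 0 ≤ expTail (M * C * t) q := expTail_nonneg (by positivity) q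
  refine squeeze_zero (fun R => mul_nonneg (hcoeff R) (add_nonneg (by positivity)
    (mul_nonneg (div_nonneg (htail _) (by positivity)) hD))) (fun R => ?_) hlim
  refine mul_le_mul_of_nonneg_left (add_le_add_right (mul_le_mul_of_nonneg_right
    (div_le_div_of_nonneg_right (expTail_le_exp ?_ _) ?_) hD) _) (hcoeff R) <;> positivity

end RangeError

section LongRangeWeights

open Finset

variable {Γ : Type*} [MetricSpace Γ] [DecidableEq Γ] {F : ℝ → ℝ} {M R : ℝ} {w : Finset Γ → ℝ}
  {𝒵 : Finset (Finset Γ)}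

namespace HasFDecay

theorem sum_not_disjoint_le_tailSup (hw : HasFDecay F M w) (hF : IsFFunction Γ F) (hR : 0 ≤ R)
    (h𝒵 : ∀ Z ∈ 𝒵, R < Metric.diam (Z : Set Γ)) (U : Finset Γ) :
    ∑ Z ∈ 𝒵 with ¬ Disjoint Z U, w Z ≤ M * tailSup Γ F (R / 2) * #U :=
  calc ∑ Z ∈ 𝒵 with ¬ Disjoint Z U, w Z
      ≤ ∑ y ∈ U, ∑ Z ∈ 𝒵 with y ∈ Z, w Z := sum_not_disjoint_le hw.nonneg 𝒵 U
    _ ≤ ∑ _y ∈ U, M * tailSup Γ F (R / 2) := sum_le_sum fun y _ => hw.sum_le_tailSup hF hR h𝒵 y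
    _ = M * tailSup Γ F (R / 2) * #U := by rw [sum_const, nsmul_eq_mul, mul_comm]

theorem sum_mul_sum_le_tailSup (hw : HasFDecay F M w) (hF : IsFFunction Γ F) (hR : 0 ≤ R)
    (h𝒵 : ∀ Z ∈ 𝒵, R < Metric.diam (Z : Set Γ)) {V : Finset Γ} (hV : ∀ Z ∈ 𝒵, Z ⊆ V) {f : Γ → ℝ}
    (hf : ∀ y, 0 ≤ f y) :
    ∑ Z ∈ 𝒵, w Z * ∑ y ∈ Z, f y ≤ M * tailSup Γ F (R / 2) * ∑ y ∈ V, f y :=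
  calc ∑ Z ∈ 𝒵, w Z * ∑ y ∈ Z, f y
      = ∑ y ∈ V, (∑ Z ∈ 𝒵 with y ∈ Z, w Z) * f y := by
        simp only [mul_sum, sum_mul]
        refine sum_comm' fun Z y => ?_
        simp only [mem_filter]
        exact ⟨fun ⟨hZ, hy⟩ => ⟨⟨hZ, hy⟩, hV Z hZ hy⟩, And.left⟩
    _ ≤ ∑ y ∈ V, M * tailSup Γ F (R / 2) * f y := by
        gcongr with y _
        exacts [hf y, hw.sum_le_tailSup hF hR h𝒵 y]
    _ = M * tailSup Γ F (R / 2) * ∑ y ∈ V, f y := by rw [mul_sum]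

end HasFDecay

end LongRangeWeights

section Truncation

open Finset Filter Topology

variable {Γ : Type*} [DecidableEq Γ] [MetricSpace Γ] {ι : Γ → Type*} {F : ℝ → ℝ} {M : ℝ}
  {L : ∀ Z : Finset Γ, LocalAlg ι Z →ₗ[ℂ] LocalAlg ι Z} {X Y Z V Λ : Finset Γ}
  {𝒵 : Finset (Finset Γ)} {t r R : ℝ}

theorem generatorRange_apply_sub_generator_apply (B : LocalAlg ι Λ) :
    generatorRange L Λ R B - generator L Λ B =
      -∑ Z ∈ Λ.powerset.filter fun Z : Finset Γ => R < Metric.diam (Z : Set Γ),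
        localTerm L Λ Z B := by
  rw [← partialGenerator_filter_diam_le, ← partialGenerator_powerset, partialGenerator,
    partialGenerator, ← sum_filter_add_sum_filter_not Λ.powerset
      fun Z : Finset Γ => Metric.diam (Z : Set Γ) ≤ R]
  simp only [not_le, LinearMap.add_apply, LinearMap.sum_apply, sub_add_cancel_left]

variable [∀ x, Fintype (ι x)] [∀ x, DecidableEq (ι x)]

theorem dynamicsRange_eq_dynamics (hR : Metric.diam (Λ : Set Γ) ≤ R) :
    dynamicsRange L Λ R t = dynamics L Λ t := by
  rw [dynamicsRange, dynamics, ← partialGenerator_filter_diam_le, ← partialGenerator_powerset,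
    filter_true_of_mem]
  exact fun Z hZ =>
    (Metric.diam_mono (coe_subset.2 (mem_powerset.1 hZ)) Λ.finite_toSet.isBounded).trans hR

namespace IsDissipativeInteraction

theorem isLindblad_generatorRange (hL : IsDissipativeInteraction F M L) :
    IsLindblad (generatorRange L Λ R) := by
  rw [← partialGenerator_filter_diam_le]
  exact isLindblad_partialGenerator hL.isLindblad

theorem isLindblad_generator (hL : IsDissipativeInteraction F M L) :
    IsLindblad (generator L Λ) := by
  rw [← partialGenerator_powerset]
  exact isLindblad_partialGenerator hL.isLindblad

theorem norm_localTerm_dynamicsRange_le (hL : IsDissipativeInteraction F M L) (hX : X ⊆ Λ)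
    (hZ : Z ⊆ Λ) (A : LocalAlg ι X) (ht : 0 ≤ t) :
    ‖localTerm L Λ Z (dynamicsRange L Λ R t (embed hX A))‖ ≤ cbWeight L Z * ‖A‖ := by
  rw [localTerm_of_subset hZ]
  refine (norm_extend_le hZ (hL.cbNorm_lt_top Z) _).trans
    (mul_le_mul_of_nonneg_left ?_ (cbWeight_nonneg Z))
  exact (norm_semigroup_apply_le hL.isLindblad_generatorRange ht _).trans (norm_embed_le hX A)

/-- Chains of sets of diameter at most `R` need more than `r / R` links to bridge a distance
larger than `r`. -/
theorem norm_localTerm_dynamicsRange_le_of_lt_dist (hL : IsDissipativeInteraction F M L)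
    (hF : IsFFunction Γ F) (hX : X ⊆ Λ) (hZ : Z ⊆ Λ) (hr : 0 ≤ r) (hR : 0 < R)
    (hXZ : ∀ x ∈ X, ∀ z ∈ Z, r < dist x z) (A : LocalAlg ι X) (ht : 0 ≤ t) :
    ‖localTerm L Λ Z (dynamicsRange L Λ R t (embed hX A))‖ ≤
      cbWeight L Z * ‖A‖ * (expTail (M * convConst Γ F * t) (r / R) *
        ((∑ x ∈ X, ∑ z ∈ Z, F (dist x z)) / convConst Γ F)) := by
  have hdisj : Disjoint Z X := disjoint_left.2 fun y hyZ hyX =>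
    (hXZ y hyX y hyZ).not_ge ((dist_self y).trans_le hr)
  have hchain : ∀ j < ⌈r / R⌉₊, (chainOp (cbWeight L)
      (Λ.powerset.filter fun Z : Finset Γ => Metric.diam (Z : Set Γ) ≤ R) ^ j) (meets X) Z = 0 :=
    fun j hj => chainOp_pow_meets_eq_zero (fun Z hZ => (mem_filter.1 hZ).2) fun x hx z hz =>
      ((lt_div_iff₀ hR).1 (Nat.lt_ceil.1 hj)).trans (hXZ x hx z hz)
  rw [localTerm_of_subset hZ, dynamicsRange, ← partialGenerator_filter_diam_le]
  exact hL.norm_extend_semigroup_embed_le hF (fun Z hZ => mem_powerset.1 (mem_filter.1 hZ).1) hX hZ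
    hdisj A ⟨hL.cbNorm_lt_top Z, (hL.isLindblad Z).map_one⟩ hchain ht

theorem sum_norm_localTerm_dynamicsRange_not_disjoint_le (hL : IsDissipativeInteraction F M L)
    (hF : IsFFunction Γ F) (h𝒵 : ∀ Z ∈ 𝒵, Z ⊆ Λ) (hdiam : ∀ Z ∈ 𝒵, R < Metric.diam (Z : Set Γ))
    (hX : X ⊆ Λ) (hR : 0 ≤ R) (A : LocalAlg ι X) (ht : 0 ≤ t) (U : Finset Γ) :
    ∑ Z ∈ 𝒵 with ¬ Disjoint Z U, ‖localTerm L Λ Z (dynamicsRange L Λ R t (embed hX A))‖ ≤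
      ‖A‖ * (M * tailSup Γ F (R / 2) * #U) :=
  calc ∑ Z ∈ 𝒵 with ¬ Disjoint Z U, ‖localTerm L Λ Z (dynamicsRange L Λ R t (embed hX A))‖
      ≤ ∑ Z ∈ 𝒵 with ¬ Disjoint Z U, cbWeight L Z * ‖A‖ := sum_le_sum fun Z hZ =>
        hL.norm_localTerm_dynamicsRange_le hX (h𝒵 Z (mem_filter.1 hZ).1) A ht
    _ = ‖A‖ * ∑ Z ∈ 𝒵 with ¬ Disjoint Z U, cbWeight L Z := by rw [← sum_mul, mul_comm]
    _ ≤ ‖A‖ * (M * tailSup Γ F (R / 2) * #U) := mul_le_mul_of_nonneg_left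
        (hL.hasFDecay.sum_not_disjoint_le_tailSup hF hR hdiam U) (norm_nonneg A)

theorem sum_norm_localTerm_dynamicsRange_le_of_lt_dist (hL : IsDissipativeInteraction F M L)
    (hF : IsFFunction Γ F) (h𝒵 : ∀ Z ∈ 𝒵, Z ⊆ V) (hdiam : ∀ Z ∈ 𝒵, R < Metric.diam (Z : Set Γ))
    (hX : X ⊆ Λ) (hV : V ⊆ Λ) (hr : 0 ≤ r) (hR : 0 < R)
    (hXV : ∀ x ∈ X, ∀ y ∈ V, r < dist x y) (A : LocalAlg ι X) (ht : 0 ≤ t) :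
    ∑ Z ∈ 𝒵, ‖localTerm L Λ Z (dynamicsRange L Λ R t (embed hX A))‖ ≤
      ‖A‖ * (M * tailSup Γ F (R / 2) * (expTail (M * convConst Γ F * t) (r / R) / convConst Γ F *
        ∑ x ∈ X, ∑ y ∈ V, F (dist x y))) := by
  set e := expTail (M * convConst Γ F * t) (r / R) / convConst Γ F
  have he : 0 ≤ e := div_nonneg (expTail_nonneg (mul_nonneg
    (mul_nonneg hL.hasFDecay.const_nonneg (convConst_nonneg Γ F)) ht) _) (convConst_nonneg Γ F)
  calc ∑ Z ∈ 𝒵, ‖localTerm L Λ Z (dynamicsRange L Λ R t (embed hX A))‖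
      ≤ ∑ Z ∈ 𝒵, ‖A‖ * e * (cbWeight L Z * ∑ y ∈ Z, ∑ x ∈ X, F (dist x y)) := by
        refine sum_le_sum fun Z hZ => (hL.norm_localTerm_dynamicsRange_le_of_lt_dist hF hX
          ((h𝒵 Z hZ).trans hV) hr hR (fun x hx y hy => hXV x hx y (h𝒵 Z hZ hy)) A ht).trans_eq ?_
        rw [sum_comm]
        ring
    _ = ‖A‖ * e * ∑ Z ∈ 𝒵, cbWeight L Z * ∑ y ∈ Z, ∑ x ∈ X, F (dist x y) := by rw [mul_sum]
    _ ≤ ‖A‖ * e * (M * tailSup Γ F (R / 2) * ∑ y ∈ V, ∑ x ∈ X, F (dist x y)) :=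
        mul_le_mul_of_nonneg_left (hL.hasFDecay.sum_mul_sum_le_tailSup hF hR.le hdiam h𝒵
          fun y => sum_nonneg fun x _ => (hF.apply_dist_pos x y).le)
          (mul_nonneg (norm_nonneg A) he)
    _ = ‖A‖ * (M * tailSup Γ F (R / 2) * (e * ∑ x ∈ X, ∑ y ∈ V, F (dist x y))) := by
        rw [sum_comm]
        ring

/-- Terms whose support meets `X(r)` are estimated by their norm, the others by the Lieb-Robinson
bound for the finite-range dynamics. -/
theorem norm_generatorRange_sub_generator_dynamicsRange_le (hL : IsDissipativeInteraction F M L)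
    (hF : IsFFunction Γ F) (hX : X ⊆ Λ) (hr : 0 ≤ r) (hR : 0 < R) (A : LocalAlg ι X)
    (ht : 0 ≤ t) :
    ‖generatorRange L Λ R (dynamicsRange L Λ R t (embed hX A)) -
        generator L Λ (dynamicsRange L Λ R t (embed hX A))‖ ≤
      ‖A‖ * rangeErrorRate F M X Λ t r R := by
  classical
  set 𝒵 := Λ.powerset.filter fun Z : Finset Γ => R < Metric.diam (Z : Set Γ) with h𝒵
  set U := Λ.filter (· ∈ inflation X r)
  set V := Λ.filter (· ∉ inflation X r)
  have hsub : ∀ Z ∈ 𝒵, Z ⊆ Λ := fun Z hZ => mem_powerset.1 (mem_filter.1 hZ).1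
  have hdiam : ∀ Z ∈ 𝒵, R < Metric.diam (Z : Set Γ) := fun Z hZ => (mem_filter.1 hZ).2
  have hG : 0 ≤ M * tailSup Γ F (R / 2) :=
    mul_nonneg hL.hasFDecay.const_nonneg (hF.tailSup_nonneg _)
  have hcard : (#U : ℝ) ≤ (inflation X r).ncard := by
    rw [← Set.ncard_coe_finset]
    exact_mod_cast Set.ncard_le_ncard (fun y hy => (mem_filter.1 hy).2)
      (hF.finite_inflation X hr)
  have hXV : ∀ x ∈ X, ∀ y ∈ V, r < dist x y := fun x hx y hy =>
    not_le.1 fun hxy => (mem_filter.1 hy).2 ⟨x, hx, (dist_comm y x).trans_le hxy⟩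
  have hZV : ∀ Z ∈ 𝒵.filter (Disjoint · U), Z ⊆ V := fun Z hZ y hy =>
    have ⟨hZ𝒵, hZU⟩ := mem_filter.1 hZ
    mem_filter.2 ⟨hsub Z hZ𝒵 hy, fun hyX =>
      disjoint_left.1 hZU hy (mem_filter.2 ⟨hsub Z hZ𝒵 hy, hyX⟩)⟩
  have hnear := hL.sum_norm_localTerm_dynamicsRange_not_disjoint_le hF hsub hdiam hX hR.le A ht U
  have hfar := hL.sum_norm_localTerm_dynamicsRange_le_of_lt_dist hF hZV
    (fun Z hZ => hdiam Z (mem_filter.1 hZ).1) hX (filter_subset _ Λ) hr hR hXV A ht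
  rw [generatorRange_apply_sub_generator_apply, norm_neg, ← h𝒵]
  refine (norm_sum_le _ _).trans ?_
  rw [← sum_filter_add_sum_filter_not 𝒵 (Disjoint · U), rangeErrorRate, mul_add, mul_add,
    add_comm]
  refine add_le_add (hnear.trans ?_) hfar
  gcongr

theorem norm_dynamicsRange_sub_dynamics_le (hL : IsDissipativeInteraction F M L)
    (hF : IsFFunction Γ F) (hX : X ⊆ Λ) (hr : 0 ≤ r) (hR : 0 < R) (A : LocalAlg ι X)
    (ht : 0 ≤ t) :
    ‖dynamicsRange L Λ R t (embed hX A) - dynamics L Λ t (embed hX A)‖ ≤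
      ‖A‖ * rangeError F M X Λ t r R := by
  have hq : 0 ≤ r / R := div_nonneg hr hR.le
  have h := norm_sub_semigroup_apply_le (y := fun s => dynamicsRange L Λ R s (embed hX A))
    (β := fun s => ‖A‖ * rangeError F M X Λ s r R) (hL.isLindblad_generator)
    (fun s => hasDerivAt_semigroup_apply (generatorRange L Λ R) (embed hX A) s)
    (by rw [rangeError_zero X Λ hq, mul_zero])
    (fun s => (hasDerivAt_rangeError X Λ hq s).const_mul ‖A‖)
    (fun s hs => hL.norm_generatorRange_sub_generator_dynamicsRange_le hF hX hr hR A hs) ht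
  simpa only [dynamicsRange, dynamics, semigroup_zero_apply] using h

theorem norm_extend_dynamics_le_add_rangeError (hL : IsDissipativeInteraction F M L)
    (hF : IsFFunction Γ F) (hX : X ⊆ Λ) (hY : Y ⊆ Λ) {K : LocalAlg ι Y →ₗ[ℂ] LocalAlg ι Y}
    (hK : cbNorm K < ∞) (hr : 0 ≤ r) (hR : 0 < R) (A : LocalAlg ι X) (ht : 0 ≤ t) :
    ‖extend hY K (dynamics L Λ t (embed hX A))‖ ≤
      ‖extend hY K (dynamicsRange L Λ R t (embed hX A))‖ +
        (cbNorm K).toReal * ‖A‖ * rangeError F M X Λ t r R := by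
  refine (norm_le_norm_add_norm_sub _ _).trans (add_le_add_right ?_ _)
  rw [← map_sub, mul_assoc]
  exact (norm_extend_le hY hK _).trans (mul_le_mul_of_nonneg_left
    (hL.norm_dynamicsRange_sub_dynamics_le hF hX hr hR A ht) ENNReal.toReal_nonneg)

end IsDissipativeInteraction

theorem tendsto_norm_extend_dynamicsRange_add_rangeError (hX : X ⊆ Λ) (hY : Y ⊆ Λ)
    (A : LocalAlg ι X) (K : LocalAlg ι Y →ₗ[ℂ] LocalAlg ι Y)
    (hE : Tendsto (fun R => rangeError F M X Λ t r R) atTop (𝓝 0)) :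
    Tendsto (fun R => ‖extend hY K (dynamicsRange L Λ R t (embed hX A))‖ +
      (cbNorm K).toReal * ‖A‖ * rangeError F M X Λ t r R) atTop
      (𝓝 ‖extend hY K (dynamics L Λ t (embed hX A))‖) := by
  have hdyn : Tendsto (fun R => ‖extend hY K (dynamicsRange L Λ R t (embed hX A))‖) atTop
      (𝓝 ‖extend hY K (dynamics L Λ t (embed hX A))‖) :=
    tendsto_const_nhds.congr' <| (eventually_ge_atTop (Metric.diam (Λ : Set Γ))).mono fun R hR => by
      simp only [dynamicsRange_eq_dynamics hR]
  simpa only [mul_zero, add_zero] using hdyn.add (hE.const_mul ((cbNorm K).toReal * ‖A‖))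

end Truncation

theorem theorem2p5 {Γ : Type*} [MetricSpace Γ] [Countable Γ] [DecidableEq Γ]
    (F : ℝ → ℝ) (hF : IsFFunction Γ F)
    {ι : Γ → Type*} [∀ x, Fintype (ι x)] [∀ x, DecidableEq (ι x)]
    (L : ∀ Z : Finset Γ, LocalAlg ι Z →ₗ[ℂ] LocalAlg ι Z)
    (hLindblad : ∀ Z, IsLindblad (L Z))
    (hL : fNorm F L < ∞)
    (X Y : Finset Γ) (hXY : Disjoint X Y)
    (Λ : Finset Γ) (hX : X ⊆ Λ) (hY : Y ⊆ Λ)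
    (A : LocalAlg ι X) (K : LocalAlg ι Y →ₗ[ℂ] LocalAlg ι Y) (hK : IsCB0 K) :
    (∀ t r R : ℝ, 0 ≤ t → 0 ≤ r → 0 < R →
      ‖extend hY K (dynamics L Λ t (embed hX A))‖ ≤
        ‖extend hY K (dynamicsRange L Λ R t (embed hX A))‖ +
          (cbNorm K).toReal * ‖A‖ * rangeError F (fNorm F L).toReal X Λ t r R) ∧
    (∀ κ ν : ℝ, IsRegularSpace Γ κ ν →
      (Summable fun n : ℕ => (1 + (n : ℝ)) ^ ν * F n) →
      ∀ t r : ℝ, 0 ≤ t → 0 ≤ r →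
        Filter.Tendsto (fun R : ℝ => rangeError F (fNorm F L).toReal X Λ t r R)
          Filter.atTop (nhds 0) ∧
        Filter.limsup (fun R : ℝ =>
            ‖extend hY K (dynamicsRange L Λ R t (embed hX A))‖ +
              (cbNorm K).toReal * ‖A‖ * rangeError F (fNorm F L).toReal X Λ t r R)
            Filter.atTop ≤
          (cbNorm K).toReal * ‖A‖ / convConst Γ F *
            (Real.exp ((fNorm F L).toReal * convConst Γ F * t) - 1) *
              ∑ x ∈ X, ∑ y ∈ Y, F (dist x y) ∧
        ‖extend hY K (dynamics L Λ t (embed hX A))‖ ≤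
          (cbNorm K).toReal * ‖A‖ / convConst Γ F *
            (Real.exp ((fNorm F L).toReal * convConst Γ F * t) - 1) *
              ∑ x ∈ X, ∑ y ∈ Y, F (dist x y)) := by
  have hM := IsDissipativeInteraction.of_fNorm_lt_top hF hLindblad hL
  refine ⟨fun t r R ht hr hR =>
    hM.norm_extend_dynamics_le_add_rangeError hF hX hY hK.1 hr hR A ht,
    fun κ ν hreg hsum t r ht _ => ?_⟩
  have hNVZ := hM.norm_extend_dynamics_embed_le hF hXY hX hY A hK ht
  have hE := tendsto_rangeError hF (hF.tendsto_tailSup hreg hsum) hM.hasFDecay.const_nonneg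
    X Λ ht r
  have hlim := tendsto_norm_extend_dynamicsRange_add_rangeError (L := L) hX hY A K hE
  exact ⟨hE, hlim.limsup_eq.trans_le hNVZ, hNVZ⟩
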